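/- For integers $1\le p\le n$ let $A$ be an $n\times p$ matrix with independent standard normal real entries, let $W_{n,p}=A^{t}A$ (the real, $\beta=1$, Laguerre or Wishart ensemble), let $X_1,X_2,\dots$ be independent standard Gaussian random points in $\mathbb R^n$, let $VP_{n,p}$ be the $p$-dimensional volume of the parallelotope spanned by $X_1,\dots,X_p$, and let $VS_{n,p}$ be the $p$-dimensional volume of the simplex with vertices $X_1,\dots,X_{p+1}$. Let $Y_{n,p}$ be one of $\log\det W_{n,p}$, $\log VP_{n,p}$, $\log VS_{n,p}$. Then $Y_{n,p}$ has finite moments of all orders and positive variance; put $Z_{n,p}=(Y_{n,p}-\mathbb E Y_{n,p})/\sqrt{\mathbb V(Y_{n,p})}$, and let $N$ be a standard normal random variable. Let $k$ be even. All sequences $p(n)$ below consist of integers with $1\le p(n)\le n$ for $n\ge 1$. (1) There is a constant $C(k)$ such that for every sequence with $p(n)=o(n)$, for all sufficiently large $n$, $$\big|\mathbb E(Z_{n,p(n)}^k)-\mathbb E(N^k)\big|\le C(k)\,\frac1{p(n)\,n}.$$ For every $c\in(0,1)$ there is a constant $C(k,c)$ such that for every sequence with $p(n)\sim c\,n$ the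 same bound, with $C(k,c)$ in place of $C(k)$, holds for all sufficiently large $n$. (2) There is a constant $C(k)$ such that for every sequence with $n-p(n)=o(n)$ (including $p(n)=n$), for all sufficiently large $n$, $$\big|\mathbb E(Z_{n,p(n)}^k)-\mathbb E(N^k)\big|\le C(k)\,\frac1{\log\frac{n}{n-p(n)+1}}.$$ Moreover, for each fixed sequence $p(\cdot)$ there is a constant, which may then depend on the sequence, for which the bound holds for all $n\ge1$ (in (2): for all $n\ge 1$ with $p(n)\ge2$, so that the logarithm is positive). -/

import Mathlib

open MeasureTheory ProbabilityTheory Filter Topology Asymptotics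

noncomputable section

namespace LogDet

/-- The `k`-th moment `E N ^ k` of a standard normal random variable `N`. -/
def normalMoment (k : ℕ) : ℝ := ∫ x, x ^ k ∂(gaussianReal 0 1)

/-- The standardisation `(X - E X) / √(V X)` of a real random variable `X`. -/
def standardize {Ω : Type*} [MeasurableSpace Ω] (P : Measure Ω) (X : Ω → ℝ) : Ω → ℝ :=
  fun ω => (X ω - ∫ ω', X ω' ∂P) / √(Var[X; P])

/-- `|E Z ^ k - E N ^ k|`, where `Z` is the standardisation of `X`. -/
def momentGap {Ω : Type*} [MeasurableSpace Ω] (P : Measure Ω) (X : Ω → ℝ) (k : ℕ) : ℝ :=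
  |(∫ ω, standardize P X ω ^ k ∂P) - normalMoment k|

/-- `X` has finite moments of all orders and positive variance, so that its standardisation and
all moments of the standardisation are meaningful. -/
def Standardizable {Ω : Type*} [MeasurableSpace Ω] (P : Measure Ω) (X : Ω → ℝ) : Prop :=
  (∀ m : ℕ, Integrable (fun ω => X ω ^ m) P) ∧ 0 < Var[X; P]

/-- The law of a real `n × p` matrix with independent standard normal entries. -/
def gaussianMatrix (n p : ℕ) : Measure (Fin n → Fin p → ℝ) :=
  Measure.pi fun _ => Measure.pi fun _ => gaussianReal 0 1

/-- The matrix `W = Aᵀ A`; for `A` distributed as `gaussianMatrix n p`, this is the real (`β = 1`)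
Laguerre (Wishart) ensemble of `p × p` matrices with `n` degrees of freedom. -/
def laguerreMatrix {n p : ℕ} (A : Fin n → Fin p → ℝ) : Matrix (Fin p) (Fin p) ℝ :=
  (Matrix.of A).transpose * Matrix.of A

/-- The log-determinant of the Laguerre matrix. -/
def logDetLaguerre {n p : ℕ} (A : Fin n → Fin p → ℝ) : ℝ := Real.log (laguerreMatrix A).det

/-- The law of `m` independent standard Gaussian random points in `ℝⁿ`. -/
def gaussianPoints (n m : ℕ) : Measure (Fin m → EuclideanSpace ℝ (Fin n)) :=
  Measure.pi fun _ => stdGaussian (EuclideanSpace ℝ (Fin n))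

/-- The `p`-dimensional volume of the parallelotope spanned by `p` vectors in `ℝⁿ`. Here `μHE[p]`
is the `p`-dimensional Hausdorff measure, normalised to be Lebesgue measure on `ℝᵖ`. -/
def parallelotopeVolume {n p : ℕ} (x : Fin p → EuclideanSpace ℝ (Fin n)) : ℝ :=
  (μHE[p] (parallelepiped x)).toReal

/-- The `p`-dimensional volume of the simplex with `p + 1` given vertices in `ℝⁿ`. -/
def simplexVolume {n p : ℕ} (x : Fin (p + 1) → EuclideanSpace ℝ (Fin n)) : ℝ :=
  (μHE[p] (convexHull ℝ (Set.range x))).toReal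

/-- The log-volume of the parallelotope. -/
def logParallelotope {n p : ℕ} (x : Fin p → EuclideanSpace ℝ (Fin n)) : ℝ :=
  Real.log (parallelotopeVolume x)

/-- The log-volume of the simplex. -/
def logSimplex {n p : ℕ} (x : Fin (p + 1) → EuclideanSpace ℝ (Fin n)) : ℝ :=
  Real.log (simplexVolume x)

/-- `|E Z ^ k - E N ^ k|` for the standardised log-determinant `Z` of the Laguerre ensemble. -/
def laguerreGap (k n p : ℕ) : ℝ :=
  momentGap (gaussianMatrix n p) (logDetLaguerre (n := n) (p := p)) k

/-- `|E Z ^ k - E N ^ k|` for the standardised log-volume `Z` of the Gaussian parallelotope. -/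
def parallelotopeGap (k n p : ℕ) : ℝ :=
  momentGap (gaussianPoints n p) (logParallelotope (n := n) (p := p)) k

/-- `|E Z ^ k - E N ^ k|` for the standardised log-volume `Z` of the Gaussian simplex. -/
def simplexGap (k n p : ℕ) : ℝ :=
  momentGap (gaussianPoints n (p + 1)) (logSimplex (n := n) (p := p)) k

end LogDet

end

/-! All three variables reduce to the logarithm of the Gram determinant of `p` independent standard
Gaussian vectors in `ℝⁿ`. The determinant of `AᵀA` is the Gram determinant of the columns, and the
parallelotope volume is the square root of a Gram determinant. The simplex volume is a constant
times the root of the Gram determinant of the edge vectors from one vertex; mixing the `p + 1`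
points by an orthonormal system orthogonal to `(1, …, 1)` turns this into a Gram determinant of `p`
independent Gaussian vectors (`exists_mix_differences`). Standardisation forgets positive affine
changes.

A new vector multiplies the Gram determinant by its squared distance to the span of the others,
which is the squared norm of a standard Gaussian vector in the orthogonal complement. Hence the
moment generating function is a product of Gamma quotients (`lintegral_exp_logDetGram`), and the
cumulants of order `b ≥ 2` are, up to sign and factorial, sums over `j < p` of Hurwitz zeta values
at `(n - j) / 2`, of size `(n - j) ^ (1 - b)`.

Moments are polynomials in cumulants. If the standardised cumulants satisfy `|κ b| ≤ K b * ε ^ (b -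
2)` for `b ≥ 3`, the even moments are within `O(ε ^ 2)` of the normal ones (`exists_moment_bound`):
a third cumulant, of order `ε`, meets an odd moment, itself `O(ε)`. For `p ≤ θ n` with `θ < 1`, `ε =
(p n) ^ (-1/2)` works. For `p` close to `n` the variance is at least `L = log (n / (n - p + 1))`,
the higher cumulants are bounded uniformly in `n` and `p`, and `ε = L ^ (-1/2)`. -/

noncomputable section

namespace LogDet

/-! ### Moments from cumulants, and comparison with the normal moments -/

/-- The `j`-th cumulant of a real random variable. -/
def cumulant {Ω : Type*} [MeasurableSpace Ω] (P : Measure Ω) (X : Ω → ℝ) (j : ℕ) : ℝ :=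
  iteratedDeriv j (cgf X P) 0

/-- Leibniz' rule at `0`, applied `k` times to `M' = M * (log M)'`, where `M` is the moment
generating function. -/
lemma integral_pow_succ_eq_sum_cumulant {Ω : Type*} [MeasurableSpace Ω] {P : Measure Ω}
    [IsProbabilityMeasure P] {X : Ω → ℝ} (h : 0 ∈ interior (integrableExpSet X P)) (k : ℕ) :
    ∫ ω, X ω ^ (k + 1) ∂P =
      ∑ i ∈ Finset.range (k + 1),
        (k.choose i : ℝ) * (∫ ω, X ω ^ i ∂P) * cumulant P X (k - i + 1) := by
  have key : deriv (mgf X P) =ᶠ[𝓝 0] fun t => mgf X P t * deriv (cgf X P) t := by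
    filter_upwards [isOpen_interior.eventually_mem h] with t ht
    have h1 := (hasDerivAt_mgf ht).differentiableAt
    have hpos : 0 < mgf X P t := mgf_pos (interior_subset (s := integrableExpSet X P) ht)
    have : deriv (cgf X P) t = deriv (mgf X P) t / mgf X P t := by
      have : cgf X P = fun t => Real.log (mgf X P t) := rfl
      rw [this]
      exact (h1.hasDerivAt.log hpos.ne').deriv
    rw [this]; field_simp
  have hm : ∀ i, ∫ ω, X ω ^ i ∂P = iteratedDeriv i (mgf X P) 0 := fun i => by
    rw [iteratedDeriv_mgf_zero h]; rfl
  have ha : AnalyticAt ℝ (deriv (cgf X P)) 0 := (analyticAt_cgf h).deriv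
  rw [hm, iteratedDeriv_succ', key.iteratedDeriv_eq,
    iteratedDeriv_fun_mul ((analyticAt_mgf h).contDiffAt) ha.contDiffAt]
  refine Finset.sum_congr rfl fun i _ => ?_
  rw [hm, cumulant, iteratedDeriv_succ']

lemma cgf_gaussianReal_zero_one : cgf id (gaussianReal 0 1) = fun t => t ^ 2 / 2 := by
  ext t; simp [cgf_gaussianReal (p := gaussianReal 0 1) (X := id) (μ := 0) (v := 1) (by simp)]

lemma normalMoment_succ (k : ℕ) : normalMoment (k + 1) = k * normalMoment (k - 1) := by
  have h0 : (0:ℝ) ∈ interior (integrableExpSet id (gaussianReal 0 1)) := by simp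
  have h := integral_pow_succ_eq_sum_cumulant h0 k
  have c1 : cumulant (gaussianReal 0 1) id 1 = 0 := by
    simp [cumulant, cgf_gaussianReal_zero_one]
  have c2 : cumulant (gaussianReal 0 1) id 2 = 1 := by
    simp [cumulant, cgf_gaussianReal_zero_one]
  have c3 : ∀ j, cumulant (gaussianReal 0 1) id (j + 3) = 0 := by
    simp [cumulant, cgf_gaussianReal_zero_one]
  simp only [id] at h
  rw [normalMoment, h]
  rcases k with _ | k
  · simp [c1]
  · rw [Finset.sum_range_succ, Finset.sum_range_succ, Finset.sum_eq_zero]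
    · simp [c1, c2, normalMoment]
    · intro i hi
      have := Finset.mem_range.1 hi
      obtain ⟨j, hj⟩ : ∃ j, k + 1 - i + 1 = j + 3 := ⟨k - 1 - i, by omega⟩
      rw [hj, c3]; simp

lemma normalMoment_zero : normalMoment 0 = 1 := by simp [normalMoment]

lemma normalMoment_odd {k : ℕ} (hk : Odd k) : normalMoment k = 0 := by
  obtain ⟨j, rfl⟩ := hk
  induction j with
  | zero => rw [normalMoment_succ]; simp
  | succ j ih =>
    rw [normalMoment_succ, show 2 * (j + 1) - 1 = 2 * j + 1 by omega, ih, mul_zero]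

/-- Moments computed recursively from cumulants that are close to those of a standard normal
variable are close to the moments of a standard normal variable. -/
lemma exists_moment_bound (K : ℕ → ℝ) (hK : ∀ b, 0 ≤ K b) (k : ℕ) :
    ∃ C : ℝ, 0 ≤ C ∧ ∀ ε : ℝ, 0 ≤ ε → ε ≤ 1 → ∀ m κ : ℕ → ℝ, m 0 = 1 → κ 1 = 0 → κ 2 = 1 →
      (∀ b, 3 ≤ b → |κ b| ≤ K b * ε ^ (b - 2)) →
      (∀ k, m (k + 1) =
        ∑ i ∈ Finset.range (k + 1), (k.choose i : ℝ) * m i * κ (k - i + 1)) →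
      |m k - normalMoment k| ≤ C * ε ∧ (Even k → |m k - normalMoment k| ≤ C * ε ^ 2) := by
  induction k using Nat.strong_induction_on with
  | _ k ih =>
  choose! C hC0 hC using ih
  match k, C, hC0, hC with
  | 0, C, hC0, hC =>
    refine ⟨0, le_rfl, fun ε _ _ m κ hm _ _ _ _ => ?_⟩
    simp [hm, normalMoment_zero]
  | 1, C, hC0, hC =>
    refine ⟨0, le_rfl, fun ε _ _ m κ hm h1 _ _ h => ?_⟩
    have := h 0
    simp only [zero_add, Finset.range_one, Nat.choose_zero_right, Finset.sum_singleton] at this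
    simp [this, h1, normalMoment_odd]
  | k + 2, C, hC0, hC =>
    let B : ℕ → ℝ := fun i => |normalMoment i| + C i
    refine ⟨(k + 1) * C k + ∑ i ∈ Finset.range k,
      ((k + 1).choose i : ℝ) * B i * K (k + 1 - i + 1), ?_, ?_⟩
    · have := hC0 k (by omega)
      refine add_nonneg (by positivity) (Finset.sum_nonneg fun i hi => ?_)
      have := Finset.mem_range.1 hi
      have := hC0 i (by omega)
      have := hK (k + 1 - i + 1)
      positivity
    intro ε h0 h1 m κ hm hκ1 hκ2 hκ hr
    -- In the recursion for `m (k + 2)` the term `i = k + 1` carries `κ 1 = 0` and the term `i = k`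
    -- carries `κ 2 = 1`; the latter matches the normal recursion.
    have hmain : m (k + 2) - normalMoment (k + 2) = (k + 1) * (m k - normalMoment k) +
        ∑ i ∈ Finset.range k, ((k + 1).choose i : ℝ) * m i * κ (k + 1 - i + 1) := by
      rw [hr (k + 1), normalMoment_succ, Finset.sum_range_succ, Finset.sum_range_succ]
      simp [hκ1, hκ2]; ring
    have hIH : ∀ i, i ≤ k → |m i - normalMoment i| ≤ C i * ε ∧
        (Even i → |m i - normalMoment i| ≤ C i * ε ^ 2) := fun i hi =>
      hC i (by omega) ε h0 h1 m κ hm hκ1 hκ2 hκ hr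
    have hB : ∀ i, i ≤ k → |m i| ≤ B i := fun i hi => by
      have h2 := (hIH i hi).1
      have h3 : |m i| ≤ |normalMoment i| + |m i - normalMoment i| := by
        have := abs_add_le (normalMoment i) (m i - normalMoment i)
        simpa using this
      have := mul_le_of_le_one_right (hC0 i (by omega)) h1
      simp only [B]; linarith
    have hterm : ∀ i ∈ Finset.range k, ∀ q : ℕ, (q = 1 ∨ (q = 2 ∧ Even k)) →
        |((k + 1).choose i : ℝ) * m i * κ (k + 1 - i + 1)| ≤
        ((k + 1).choose i : ℝ) * B i * K (k + 1 - i + 1) * ε ^ q := by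
      intro i hi q hq
      have hi := Finset.mem_range.1 hi
      have hκi := hκ (k + 1 - i + 1) (by omega)
      have hKi := hK (k + 1 - i + 1)
      have hBi := hB i (by omega)
      have hB0 : 0 ≤ B i := (abs_nonneg _).trans hBi
      rw [abs_mul, abs_mul, Nat.abs_cast, mul_assoc, mul_assoc, mul_assoc]
      refine mul_le_mul_of_nonneg_left ?_ (Nat.cast_nonneg _)
      -- The cumulant of order `k + 2 - i` alone gives `ε ^ (k - i)`. This is too weak only for `q =
      -- 2`, `i = k - 1`; then `i` is odd, the normal moment vanishes, and `m i` supplies the second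
      -- factor `ε`.
      by_cases hlast : q ≤ k - i
      · have h4 : |κ (k + 1 - i + 1)| ≤ K (k + 1 - i + 1) * ε ^ q := hκi.trans
          (mul_le_mul_of_nonneg_left (pow_le_pow_of_le_one h0 h1 (by omega)) hKi)
        calc _ ≤ B i * (K (k + 1 - i + 1) * ε ^ q) :=
              mul_le_mul hBi h4 (abs_nonneg _) hB0
          _ = _ := by ring
      · obtain ⟨rfl, hk⟩ : q = 2 ∧ Even k := by
          rcases hq with rfl | hq
          · omega
          · exact hq
        have hodd : Odd i := by
          have : k = i + 1 := by omega
          subst this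
          exact Nat.not_even_iff_odd.1 (Nat.even_add_one.1 hk)
        have h5 := (hIH i (by omega)).1
        rw [normalMoment_odd hodd, sub_zero] at h5
        have h6 : |m i| ≤ B i * ε := h5.trans (mul_le_mul_of_nonneg_right (by simp [B]) h0)
        have h7 : |κ (k + 1 - i + 1)| ≤ K (k + 1 - i + 1) * ε := by
          refine hκi.trans (le_of_eq ?_)
          rw [show k + 1 - i + 1 - 2 = 1 by omega, pow_one]
        calc _ ≤ (B i * ε) * (K (k + 1 - i + 1) * ε) :=
              mul_le_mul h6 h7 (abs_nonneg _) (by positivity)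
          _ = _ := by ring
    have hsum : ∀ q : ℕ, (q = 1 ∨ (q = 2 ∧ Even k)) →
        |m k - normalMoment k| ≤ C k * ε ^ q →
        |m (k + 2) - normalMoment (k + 2)| ≤ ((k + 1) * C k + ∑ i ∈ Finset.range k,
      ((k + 1).choose i : ℝ) * B i * K (k + 1 - i + 1)) * ε ^ q := by
      intro q hq hk
      rw [hmain, add_mul _ _ (ε ^ q), Finset.sum_mul]
      refine (abs_add_le _ _).trans (add_le_add ?_ ?_)
      · rw [abs_mul, abs_of_nonneg (by positivity : (0:ℝ) ≤ k + 1), mul_assoc]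
        exact mul_le_mul_of_nonneg_left hk (by positivity)
      · exact (Finset.abs_sum_le_sum_abs _ _).trans
          (Finset.sum_le_sum fun i hi => hterm i hi q hq)
    have hk2 := hIH k le_rfl
    refine ⟨?_, fun he => ?_⟩
    · simpa using hsum 1 (Or.inl rfl) (by simpa using hk2.1)
    · have he' : Even k := by rwa [Nat.even_add, iff_true_right even_two] at he
      exact hsum 2 (Or.inr ⟨rfl, he'⟩) (hk2.2 he')

/-! ### Hurwitz zeta sums and the derivatives of log Gamma -/

/-- The Hurwitz zeta series `∑ 1 / (x + m) ^ j`. -/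
def hurwitzSum (j : ℕ) (x : ℝ) : ℝ := ∑' m : ℕ, ((x + m) ^ j)⁻¹

lemma summable_hurwitz {j : ℕ} (hj : 2 ≤ j) {x : ℝ} (hx : 0 < x) :
    Summable fun m : ℕ => ((x + m) ^ j)⁻¹ := by
  have h : Summable fun m : ℕ => ((m : ℝ) ^ j)⁻¹ := Real.summable_nat_pow_inv.2 (by omega)
  rw [← summable_nat_add_iff 1] at h ⊢
  refine Summable.of_nonneg_of_le (fun m => by positivity) (fun m => ?_) h
  have : (0:ℝ) < ((m + 1 : ℕ) : ℝ) := by positivity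
  gcongr
  linarith

lemma hasDerivAt_hurwitzSum {j : ℕ} (hj : 2 ≤ j) {x : ℝ} (hx : 0 < x) :
    HasDerivAt (hurwitzSum j) (-j * hurwitzSum (j + 1) x) x := by
  have hx2 : 0 < x / 2 := by positivity
  have key := hasDerivAt_tsum_of_isPreconnected (𝕜 := ℝ) (t := Set.Ioi (x / 2))
    (g := fun (m : ℕ) (y : ℝ) => ((y + m) ^ j)⁻¹)
    (g' := fun (m : ℕ) (y : ℝ) => -j * ((y + m) ^ (j + 1))⁻¹)
    (u := fun m : ℕ => j * ((x / 2 + m) ^ (j + 1))⁻¹) (y₀ := x) (y := x)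
    ((summable_hurwitz (j := j + 1) (by omega) hx2).mul_left _) isOpen_Ioi
    isPreconnected_Ioi ?_ ?_ (by simpa using hx) (summable_hurwitz hj hx) (by simpa using hx)
  · rw [tsum_mul_left] at key
    exact key
  · intro m y hy
    have hy : x / 2 < y := hy
    have hpos : 0 < y + m := by linarith [Nat.cast_nonneg (α := ℝ) m]
    have h1 : HasDerivAt (fun y : ℝ => y + m) 1 y := (hasDerivAt_id y).add_const _
    convert! (h1.pow j).inv (pow_ne_zero _ hpos.ne') using 1
    obtain ⟨i, rfl⟩ : ∃ i, j = i + 1 := ⟨j - 1, by omega⟩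
    field_simp
    simp
    ring
  · intro m y hy
    have hy : x / 2 < y := hy
    have hpos : 0 < x / 2 + m := by positivity
    have hpos' : 0 < y + m := by linarith
    rw [norm_mul, norm_neg, Real.norm_natCast, Real.norm_of_nonneg (by positivity)]
    gcongr

lemma hasSum_telescope {x : ℝ} (hx : 0 < x) :
    HasSum (fun m : ℕ => (x + m)⁻¹ - (x + (m + 1 : ℕ))⁻¹) x⁻¹ := by
  have hlim : Tendsto (fun m : ℕ => (x + m)⁻¹) atTop (𝓝 0) :=
    (tendsto_atTop_add_const_left _ x tendsto_natCast_atTop_atTop).inv_tendsto_atTop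
  rw [hasSum_iff_tendsto_nat_of_nonneg]
  · simp_rw [fun n => Finset.sum_range_sub' (fun m : ℕ => (x + m)⁻¹) n]
    simpa using hlim.const_sub x⁻¹
  · intro m
    rw [sub_nonneg]
    have : 0 < x + m := by positivity
    gcongr
    linarith

/-- Termwise, `1 / (y (y + 1)) ≤ 1 / y ^ 2` with `y = x + m`, and the left sides telescope to `1 /
x`. -/
lemma inv_le_hurwitzSum_two {x : ℝ} (hx : 0 < x) : x⁻¹ ≤ hurwitzSum 2 x := by
  rw [← (hasSum_telescope hx).tsum_eq]
  refine (hasSum_telescope hx).summable.tsum_le_tsum (fun m => ?_) (summable_hurwitz le_rfl hx)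
  have h : 0 < x + m := by positivity
  have h' : 0 < x + (m + 1 : ℕ) := by positivity
  rw [inv_sub_inv h.ne' h'.ne', ← one_div, div_le_div_iff₀ (by positivity) (by positivity)]
  push_cast
  nlinarith

/-- The terms `m ≥ 1` are dominated by the telescoping series, and the term `m = 0` is at most `2 /
x` because `x ≥ 1 / 2`. The threshold `1 / 2` is the half of the smallest possible number of degrees
of freedom. -/
lemma hurwitzSum_two_le {x : ℝ} (hx : 1 / 2 ≤ x) : hurwitzSum 2 x ≤ 3 * x⁻¹ := by
  have hx0 : 0 < x := by linarith
  have h1 : ∑' m : ℕ, ((x + (m + 1 : ℕ)) ^ 2)⁻¹ ≤ x⁻¹ := by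
    rw [← (hasSum_telescope hx0).tsum_eq]
    refine Summable.tsum_le_tsum (fun m => ?_)
      ((summable_nat_add_iff 1).2 (summable_hurwitz le_rfl hx0)) (hasSum_telescope hx0).summable
    have h : 0 < x + m := by positivity
    have h' : 0 < x + (m + 1 : ℕ) := by positivity
    rw [inv_sub_inv h.ne' h'.ne', ← one_div, div_le_div_iff₀ (by positivity) (by positivity)]
    push_cast
    nlinarith
  rw [hurwitzSum, (summable_hurwitz le_rfl hx0).tsum_eq_zero_add]
  have h2 : ((x + (0 : ℕ)) ^ 2)⁻¹ ≤ 2 * x⁻¹ := by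
    rw [Nat.cast_zero, add_zero, ← div_eq_mul_inv, ← one_div, div_le_div_iff₀ (by positivity) hx0]
    nlinarith
  linarith

lemma hurwitzSum_nonneg (j : ℕ) {x : ℝ} (hx : 0 < x) : 0 ≤ hurwitzSum j x :=
  tsum_nonneg fun m => by positivity

lemma hurwitzSum_le {j : ℕ} {x : ℝ} (hx : 1 / 2 ≤ x) :
    hurwitzSum (j + 2) x ≤ 3 * (x⁻¹) ^ (j + 1) := by
  have hx0 : 0 < x := by linarith
  calc hurwitzSum (j + 2) x ≤ ∑' m : ℕ, (x⁻¹) ^ j * ((x + m) ^ 2)⁻¹ := by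
        refine (summable_hurwitz (by omega) hx0).tsum_le_tsum (fun m => ?_)
          ((summable_hurwitz le_rfl hx0).mul_left _)
        rw [pow_add, mul_inv, inv_pow]
        gcongr
        simp
    _ = (x⁻¹) ^ j * hurwitzSum 2 x := tsum_mul_left
    _ ≤ (x⁻¹) ^ j * (3 * x⁻¹) :=
        mul_le_mul_of_nonneg_left (hurwitzSum_two_le hx) (by positivity)
    _ = _ := by ring

/-- The terms of the logarithm of the Weierstrass product of the Gamma function. -/
def logGammaTerm (m : ℕ) (x : ℝ) : ℝ :=
  x * (Real.log (m + 2) - Real.log (m + 1)) + Real.log (m + 1) - Real.log (x + (m + 1 : ℕ))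

/-- Identifies the limit of the series: the partial sums are the Bohr–Mollerup sequence up to `log
x` and a correction tending to `0`. -/
lemma sum_logGammaTerm (x : ℝ) (n : ℕ) :
    ∑ m ∈ Finset.range n, logGammaTerm m x =
      Real.BohrMollerup.logGammaSeq x n + Real.log x + x * (Real.log (n + 1) - Real.log n) := by
  rw [Real.BohrMollerup.logGammaSeq, Finset.sum_range_succ']
  have h : ∑ m ∈ Finset.range n, logGammaTerm m x = x * Real.log (n + 1) +
      Real.log n.factorial - ∑ m ∈ Finset.range n, Real.log (x + (m + 1 : ℕ)) := by
    induction n with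
    | zero => simp
    | succ n ih =>
      rw [Finset.sum_range_succ, ih, Finset.sum_range_succ, logGammaTerm, Nat.factorial_succ,
        Nat.cast_mul, Real.log_mul (by positivity) (by positivity)]
      push_cast
      ring_nf
  rw [h]
  simp
  ring

/-- The derivative of `logGammaTerm`. -/
def digammaTerm (m : ℕ) (x : ℝ) : ℝ :=
  Real.log (m + 2) - Real.log (m + 1) - (x + (m + 1 : ℕ))⁻¹

lemma hasDerivAt_logGammaTerm (m : ℕ) {x : ℝ} (hx : 0 < x) :
    HasDerivAt (logGammaTerm m) (digammaTerm m x) x := by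
  have hpos : 0 < x + (m + 1 : ℕ) := by positivity
  have h1 : HasDerivAt (fun y : ℝ => y + (m + 1 : ℕ)) 1 x := (hasDerivAt_id x).add_const _
  have h2 := (((hasDerivAt_id x).mul_const (Real.log (m + 2) - Real.log (m + 1))).add_const
    (Real.log (m + 1))).sub (h1.log hpos.ne')
  convert! h2 using 1
  simp [digammaTerm]

lemma hasDerivAt_digammaTerm (m : ℕ) {x : ℝ} (hx : 0 < x) :
    HasDerivAt (digammaTerm m) ((x + (m + 1 : ℕ)) ^ 2)⁻¹ x := by
  have hpos : 0 < x + (m + 1 : ℕ) := by positivity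
  have h1 : HasDerivAt (fun y : ℝ => y + (m + 1 : ℕ)) 1 x := (hasDerivAt_id x).add_const _
  have h2 := (h1.inv hpos.ne').const_sub (Real.log (m + 2) - Real.log (m + 1))
  convert! h2 using 1
  field_simp

/-- The logarithmic increment lies between `1 / (m + 2)` and `1 / (m + 1)`, so the difference is
`O(1 / (m + 1) ^ 2)`, uniformly for `0 < x < R`. This domination justifies termwise differentiation.
-/
lemma abs_digammaTerm_le (m : ℕ) {x R : ℝ} (hx : 0 < x) (hR : x < R) :
    |digammaTerm m x| ≤ (R + 1) * (((m + 1 : ℕ) : ℝ) ^ 2)⁻¹ := by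
  have hm : (0:ℝ) < m + 1 := by positivity
  have hlog : Real.log (m + 2) - Real.log (m + 1) = Real.log (1 + (m + 1 : ℝ)⁻¹) := by
    rw [← Real.log_div (by positivity) (by positivity)]
    congr 1; field_simp; ring
  have hup : Real.log (1 + (m + 1 : ℝ)⁻¹) ≤ (m + 1 : ℝ)⁻¹ := by
    have := Real.log_le_sub_one_of_pos (show 0 < 1 + (m + 1 : ℝ)⁻¹ by positivity)
    linarith
  have hlo : (m + 2 : ℝ)⁻¹ ≤ Real.log (1 + (m + 1 : ℝ)⁻¹) := by
    have := Real.one_sub_inv_le_log_of_pos (show 0 < 1 + (m + 1 : ℝ)⁻¹ by positivity)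
    convert this using 1
    field_simp; ring
  rw [digammaTerm, hlog, abs_le]
  push_cast
  have e1 : (m + 1 : ℝ)⁻¹ - (x + (m + 1))⁻¹ ≤ (R + 1) * ((m + 1 : ℝ) ^ 2)⁻¹ := by
    rw [inv_sub_inv hm.ne' (by positivity), ← div_eq_mul_inv,
      div_le_div_iff₀ (by positivity) (by positivity)]
    have : x * (m + 1 : ℝ) ^ 2 ≤ (R + 1) * (m + 1) ^ 2 := by gcongr; linarith
    have : 0 ≤ (R + 1) * ((m + 1) * x) := by
      have : 0 < R := hx.trans hR
      positivity
    nlinarith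
  have e2 : (x + (m + 1 : ℝ))⁻¹ - (m + 2 : ℝ)⁻¹ ≤ (R + 1) * ((m + 1 : ℝ) ^ 2)⁻¹ := by
    have h1 : (x + (m + 1 : ℝ))⁻¹ ≤ (m + 1 : ℝ)⁻¹ := inv_anti₀ hm (by linarith)
    have h2 : (m + 1 : ℝ)⁻¹ - (m + 2 : ℝ)⁻¹ ≤ 1 * ((m + 1 : ℝ) ^ 2)⁻¹ := by
      rw [inv_sub_inv hm.ne' (by positivity), ← div_eq_mul_inv,
        div_le_div_iff₀ (by positivity) (by positivity)]
      nlinarith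
    have h3 : 1 * ((m + 1 : ℝ) ^ 2)⁻¹ ≤ (R + 1) * ((m + 1 : ℝ) ^ 2)⁻¹ := by
      gcongr; linarith
    linarith
  constructor <;> linarith

lemma summable_succ_sq_inv : Summable fun m : ℕ => (((m + 1 : ℕ) : ℝ) ^ 2)⁻¹ :=
  (summable_nat_add_iff 1).2 (Real.summable_nat_pow_inv.2 one_lt_two)

lemma summable_logGammaTerm_one : Summable fun m => logGammaTerm m 1 := by
  have : (fun m => logGammaTerm m 1) = 0 := by
    ext m
    simp only [logGammaTerm, Pi.zero_apply]
    push_cast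
    rw [show (1 + (m + 1) : ℝ) = m + 2 by ring]
    ring
  rw [this]
  exact summable_zero

lemma summable_logGammaTerm {x : ℝ} (hx : 0 < x) : Summable fun m => logGammaTerm m x := by
  refine summable_of_summable_hasDerivAt_of_isPreconnected (t := Set.Ioo 0 (x + 2)) (y₀ := 1)
    (summable_succ_sq_inv.mul_left (x + 2 + 1)) isOpen_Ioo isPreconnected_Ioo
    (fun m y hy => hasDerivAt_logGammaTerm m hy.1) (fun m y hy => abs_digammaTerm_le m hy.1 hy.2)
    ⟨by norm_num, by linarith⟩ summable_logGammaTerm_one ⟨hx, by linarith⟩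

lemma summable_digammaTerm {x : ℝ} (hx : 0 < x) : Summable fun m => digammaTerm m x :=
  Summable.of_norm_bounded (summable_succ_sq_inv.mul_left (x + 1 + 1))
    fun m => abs_digammaTerm_le m hx (by linarith)

lemma log_Gamma_eq_tsum {x : ℝ} (hx : 0 < x) :
    Real.log (Real.Gamma x) = ∑' m, logGammaTerm m x - Real.log x := by
  have h1 := (summable_logGammaTerm hx).hasSum.tendsto_sum_nat
  simp_rw [sum_logGammaTerm] at h1
  have h2 := ((Real.BohrMollerup.tendsto_log_gamma hx).add_const (Real.log x)).add
    (Real.tendsto_log_nat_add_one_sub_log.const_mul x)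
  have := tendsto_nhds_unique h1 h2
  linarith

lemma hasDerivAt_log_Gamma {x : ℝ} (hx : 0 < x) :
    HasDerivAt (fun y => Real.log (Real.Gamma y)) (∑' m, digammaTerm m x - x⁻¹) x := by
  have h1 : HasDerivAt (fun y => ∑' m, logGammaTerm m y) (∑' m, digammaTerm m x) x :=
    hasDerivAt_tsum_of_isPreconnected (t := Set.Ioo 0 (x + 2)) (y₀ := 1)
      (summable_succ_sq_inv.mul_left (x + 2 + 1)) isOpen_Ioo isPreconnected_Ioo
      (fun m y hy => hasDerivAt_logGammaTerm m hy.1)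
      (fun m y hy => abs_digammaTerm_le m hy.1 hy.2)
      ⟨by norm_num, by linarith⟩ summable_logGammaTerm_one ⟨hx, by linarith⟩
  refine (h1.sub (Real.hasDerivAt_log hx.ne')).congr_of_eventuallyEq ?_
  filter_upwards [isOpen_Ioi.mem_nhds hx] with y hy using log_Gamma_eq_tsum hy

/-- The differentiated series starts at `m + 1`; the derivative of `-1 / y` supplies the missing
zeroth term of the Hurwitz sum. -/
lemma hasDerivAt_digamma {x : ℝ} (hx : 0 < x) :
    HasDerivAt (fun y : ℝ => ∑' m, digammaTerm m y - y⁻¹) (hurwitzSum 2 x) x := by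
  have h1 : HasDerivAt (fun y => ∑' m, digammaTerm m y)
      (∑' m : ℕ, ((x + (m + 1 : ℕ)) ^ 2)⁻¹) x := by
    refine hasDerivAt_tsum_of_isPreconnected (t := Set.Ioi 0) (y₀ := x)
      summable_succ_sq_inv isOpen_Ioi isPreconnected_Ioi
      (fun m y hy => hasDerivAt_digammaTerm m hy) (fun m y hy => ?_) hx
      (summable_digammaTerm hx) hx
    have hy : 0 < y := hy
    rw [Real.norm_of_nonneg (by positivity)]
    gcongr
    linarith
  convert! h1.sub (hasDerivAt_inv hx.ne') using 1
  rw [hurwitzSum, (summable_hurwitz le_rfl hx).tsum_eq_zero_add]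
  simp; ring

lemma iteratedDeriv_log_Gamma (j : ℕ) {x : ℝ} (hx : 0 < x) :
    iteratedDeriv (j + 2) (fun y => Real.log (Real.Gamma y)) x =
      (-1) ^ j * (j + 1).factorial * hurwitzSum (j + 2) x := by
  induction j generalizing x with
  | zero =>
    rw [zero_add, iteratedDeriv_succ, iteratedDeriv_one]
    have : deriv (fun y => Real.log (Real.Gamma y)) =ᶠ[𝓝 x]
        fun y : ℝ => ∑' m, digammaTerm m y - y⁻¹ := by
      filter_upwards [isOpen_Ioi.mem_nhds hx] with y hy using (hasDerivAt_log_Gamma hy).deriv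
    rw [this.deriv_eq, (hasDerivAt_digamma hx).deriv]
    simp
  | succ j ih =>
    rw [iteratedDeriv_succ]
    have : iteratedDeriv (j + 2) (fun y => Real.log (Real.Gamma y)) =ᶠ[𝓝 x]
        fun y => (-1) ^ j * (j + 1).factorial * hurwitzSum (j + 2) y := by
      filter_upwards [isOpen_Ioi.mem_nhds hx] with y hy using ih hy
    rw [this.deriv_eq, ((hasDerivAt_hurwitzSum (by omega) hx).const_mul _).deriv,
      Nat.factorial_succ (j + 1)]
    push_cast
    ring

/-- Complex differentiability on the right half-plane gives analyticity, which restricts to the real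
axis. -/
lemma analyticAt_log_Gamma {x : ℝ} (hx : 0 < x) :
    AnalyticAt ℝ (fun y => Real.log (Real.Gamma y)) x := by
  have h1 : AnalyticAt ℂ Complex.Gamma x := by
    refine DifferentiableOn.analyticAt (s := {z : ℂ | 0 < z.re}) (fun z hz => ?_)
      ((isOpen_lt continuous_const Complex.continuous_re).mem_nhds (by simpa using hx))
    refine (Complex.differentiableAt_Gamma z fun m h => ?_).differentiableWithinAt
    have hz : 0 < z.re := hz
    rw [h] at hz
    simp at hz
    linarith [Nat.cast_nonneg (α := ℝ) m]
  have h2 : AnalyticAt ℝ Real.Gamma x := h1.re_ofReal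
  exact h2.log (Real.Gamma_pos_of_pos hx)

/-! ### Cumulants of a standardised variable -/

lemma integrableExpSet_add_const {Ω : Type*} [MeasurableSpace Ω] {P : Measure Ω} {X : Ω → ℝ}
    (c : ℝ) :
    integrableExpSet (fun ω => X ω + c) P = integrableExpSet X P := by
  ext t
  simp only [integrableExpSet, Set.mem_ofPred_eq, mul_add, Real.exp_add]
  exact integrable_mul_const_iff (IsUnit.mk0 _ (Real.exp_ne_zero _)) _

section Standardize

variable {Ω : Type*} [MeasurableSpace Ω] {P : Measure Ω} [IsProbabilityMeasure P] {X : Ω → ℝ}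

lemma cumulant_one (h : 0 ∈ interior (integrableExpSet X P)) : cumulant P X 1 = ∫ ω, X ω ∂P := by
  rw [cumulant, iteratedDeriv_one, deriv_cgf_zero h]
  simp

lemma cumulant_two (h : 0 ∈ interior (integrableExpSet X P)) : cumulant P X 2 = Var[X; P] := by
  rw [cumulant, iteratedDeriv_two_cgf_eq_integral h, deriv_cgf_zero h,
    variance_eq_integral (aemeasurable_of_mem_interior_integrableExpSet h)]
  simp

/-- A shift adds a linear term to the cumulant generating function, which two derivatives kill. -/
lemma cumulant_add_const (h : 0 ∈ interior (integrableExpSet X P)) (c : ℝ) (b : ℕ) :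
    cumulant P (fun ω => X ω + c) (b + 2) = cumulant P X (b + 2) := by
  have h1 : cgf (fun ω => X ω + c) P =ᶠ[𝓝 0] fun t => cgf X P t + t * c := by
    filter_upwards [isOpen_interior.eventually_mem h] with t ht
    have hpos : 0 < mgf X P t := mgf_pos (interior_subset (s := integrableExpSet X P) ht)
    rw [cgf, mgf_add_const, Real.log_mul hpos.ne' (Real.exp_ne_zero _), Real.log_exp, cgf]
  rw [cumulant, h1.iteratedDeriv_eq, iteratedDeriv_fun_add (analyticAt_cgf h).contDiffAt
    (by fun_prop), cumulant]
  simp [iteratedDeriv_succ']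

/-- The hypothesis `hC` is the conclusion of `exists_moment_bound`, so that `C` is fixed before the
measure is chosen. -/
lemma momentGap_le_of_cumulant {K : ℕ → ℝ} {k : ℕ} {C : ℝ} (hk : Even k)
    (hC : ∀ ε : ℝ, 0 ≤ ε → ε ≤ 1 → ∀ m κ : ℕ → ℝ, m 0 = 1 → κ 1 = 0 → κ 2 = 1 →
      (∀ b, 3 ≤ b → |κ b| ≤ K b * ε ^ (b - 2)) →
      (∀ k, m (k + 1) =
        ∑ i ∈ Finset.range (k + 1), (k.choose i : ℝ) * m i * κ (k - i + 1)) →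
      |m k - normalMoment k| ≤ C * ε ∧ (Even k → |m k - normalMoment k| ≤ C * ε ^ 2))
    (h : 0 ∈ interior (integrableExpSet X P)) (hpos : 0 < cumulant P X 2) {ε : ℝ} (h0 : 0 ≤ ε)
    (h1 : ε ≤ 1)
    (hκ : ∀ b, |cumulant P X (b + 3)| ≤ K (b + 3) * ε ^ (b + 1) * √(cumulant P X 2) ^ (b + 3)) :
    momentGap P X k ≤ C * ε ^ 2 := by
  set σ := √(cumulant P X 2) with hσ
  have hσ0 : 0 < σ := Real.sqrt_pos.2 hpos
  let c := -∫ ω, X ω ∂P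
  let X' := fun ω => X ω + c
  have h' : 0 ∈ interior (integrableExpSet X' P) := by rwa [integrableExpSet_add_const]
  have hint : Integrable X P := integrable_of_mem_interior_integrableExpSet h
  have hc1 : cumulant P X' 1 = 0 := by
    rw [cumulant_one h', integral_add hint (integrable_const _)]
    simp [c]
  have hm : ∀ i, ∫ ω, standardize P X ω ^ i ∂P = (∫ ω, X' ω ^ i ∂P) / σ ^ i := fun i => by
    rw [← integral_div]
    refine integral_congr_ae (.of_forall fun ω => ?_)
    simp only [standardize, ← cumulant_two h, div_pow, ← hσ, X', c, sub_eq_add_neg]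
  refine (hC ε h0 h1 (fun i => ∫ ω, standardize P X ω ^ i ∂P)
    (fun b => cumulant P X' b / σ ^ b) (by simp) (by simp [hc1]) ?_ ?_ ?_).2 hk
  · rw [cumulant_add_const h c 0, hσ, Real.sq_sqrt hpos.le, zero_add, div_self hpos.ne']
  · intro b hb
    obtain ⟨b, rfl⟩ : ∃ i, b = i + 3 := ⟨b - 3, by omega⟩
    rw [cumulant_add_const h c (b + 1), abs_div, abs_of_pos (pow_pos hσ0 _),
      div_le_iff₀ (pow_pos hσ0 _)]
    exact hκ b
  -- Scaling is done in the recursion itself: dividing it by `σ ^ (k + 1)` splits this power between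
  -- moment and cumulant.
  · intro k
    simp only [hm]
    rw [integral_pow_succ_eq_sum_cumulant h', Finset.sum_div]
    refine Finset.sum_congr rfl fun i hi => ?_
    have hi := Finset.mem_range.1 hi
    have : σ ^ (k + 1) = σ ^ i * σ ^ (k - i + 1) := by rw [← pow_add]; congr 1; omega
    rw [this]
    field_simp

end Standardize

/-! ### Cumulant bounds for sums of log chi-square variables -/

/-- `Y` has the moment generating function of the sum of independent logarithms of chi-square
variables with `n`, `n - 1`, ..., `n - p + 1` degrees of freedom. -/
structure IsLogChiSqSum {Ω : Type*} [MeasurableSpace Ω] (n p : ℕ) (P : Measure Ω) (Y : Ω → ℝ) :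
    Prop where
  isProbabilityMeasure : IsProbabilityMeasure P
  integrable : ∀ s : ℝ, -(1 / 2) < s → Integrable (fun ω => Real.exp (s * Y ω)) P
  mgf_eq : ∀ s : ℝ, -(1 / 2) < s → mgf Y P s = ∏ j ∈ Finset.range p,
    (2 ^ s * Real.Gamma (((n - j : ℕ) : ℝ) / 2 + s) / Real.Gamma (((n - j : ℕ) : ℝ) / 2))

namespace IsLogChiSqSum

variable {Ω : Type*} [MeasurableSpace Ω] {n p : ℕ} {P : Measure Ω} {Y : Ω → ℝ}

lemma mem_interior (h : IsLogChiSqSum n p P Y) : 0 ∈ interior (integrableExpSet Y P) := by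
  rw [mem_interior_iff_mem_nhds]
  filter_upwards [isOpen_Ioi.mem_nhds (show (0:ℝ) ∈ Set.Ioi (-(1/2)) by simp)] with s hs
    using h.integrable s hs

/-- Near `0` the logarithm of the product is an affine function of `s` plus a sum of shifted log
Gammas; only the latter survive two derivatives. -/
lemma cumulant_eq (h : IsLogChiSqSum n p P Y) (hpn : p ≤ n) (b : ℕ) :
    cumulant P Y (b + 2) = (-1) ^ b * (b + 1).factorial *
      ∑ j ∈ Finset.range p, hurwitzSum (b + 2) (((n - j : ℕ) : ℝ) / 2) := by
  have hx : ∀ j ∈ Finset.range p, (1:ℝ) / 2 ≤ ((n - j : ℕ) : ℝ) / 2 := fun j hj => by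
    have := Finset.mem_range.1 hj
    have : (1:ℝ) ≤ ((n - j : ℕ) : ℝ) := by exact_mod_cast (by omega : 1 ≤ n - j)
    linarith
  have hev : cgf Y P =ᶠ[𝓝 0] fun s => ∑ j ∈ Finset.range p,
      (s * Real.log 2 - Real.log (Real.Gamma (((n - j : ℕ) : ℝ) / 2)) +
        Real.log (Real.Gamma (((n - j : ℕ) : ℝ) / 2 + s))) := by
    filter_upwards [isOpen_Ioi.mem_nhds (show (0:ℝ) ∈ Set.Ioi (-(1/2)) by simp)] with s hs
    have hs : -(1 / 2) < s := hs
    have hg : ∀ j ∈ Finset.range p, 0 < Real.Gamma (((n - j : ℕ) : ℝ) / 2 + s) := fun j hj =>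
      Real.Gamma_pos_of_pos (by linarith [hx j hj])
    have hg' : ∀ j ∈ Finset.range p, 0 < Real.Gamma (((n - j : ℕ) : ℝ) / 2) := fun j hj =>
      Real.Gamma_pos_of_pos (by linarith [hx j hj])
    rw [cgf, h.mgf_eq s hs, Real.log_prod]
    · refine Finset.sum_congr rfl fun j hj => ?_
      rw [Real.log_div (mul_pos (by positivity) (hg j hj)).ne' (hg' j hj).ne',
        Real.log_mul (by positivity) (hg j hj).ne', Real.log_rpow two_pos]
      ring
    · intro j hj
      have := hg j hj
      have := hg' j hj
      positivity
  have hlin : ∀ a c : ℝ, iteratedDeriv (b + 2) (fun s : ℝ => s * a - c) 0 = 0 := fun a c => by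
    simp [iteratedDeriv_succ']
  have han : ∀ j ∈ Finset.range p, AnalyticAt ℝ
      (fun s => Real.log (Real.Gamma (((n - j : ℕ) : ℝ) / 2 + s))) 0 := fun j hj => by
    have h1 : AnalyticAt ℝ (fun s : ℝ => ((n - j : ℕ) : ℝ) / 2 + s) 0 := by fun_prop
    have hj := hx j hj
    exact AnalyticAt.fun_comp (g := fun y => Real.log (Real.Gamma y))
      (analyticAt_log_Gamma (by linarith)) h1
  rw [cumulant, hev.iteratedDeriv_eq, iteratedDeriv_fun_sum, Finset.mul_sum]
  · refine Finset.sum_congr rfl fun j hj => ?_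
    rw [iteratedDeriv_fun_add (by fun_prop) (han j hj).contDiffAt, hlin, zero_add,
      iteratedDeriv_comp_const_add (b + 2) (fun y => Real.log (Real.Gamma y))]
    have hj := hx j hj
    simp only [add_zero]
    exact iteratedDeriv_log_Gamma b (by linarith)
  · intro j hj
    exact ContDiffAt.add (by fun_prop) (han j hj).contDiffAt

lemma sum_le_cumulant_two (h : IsLogChiSqSum n p P Y) (hpn : p ≤ n) :
    ∑ j ∈ Finset.range p, 2 / ((n - j : ℕ) : ℝ) ≤ cumulant P Y 2 := by
  have := h.cumulant_eq hpn 0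
  rw [zero_add] at this
  rw [this]
  simp only [pow_zero, Nat.factorial, one_mul, Nat.cast_one, Nat.mul_one]
  refine Finset.sum_le_sum fun j hj => ?_
  have := Finset.mem_range.1 hj
  have h1 : (0:ℝ) < ((n - j : ℕ) : ℝ) := by exact_mod_cast (by omega : 0 < n - j)
  refine le_trans (le_of_eq ?_) (inv_le_hurwitzSum_two (by positivity))
  rw [inv_div]

lemma le_cumulant_two (h : IsLogChiSqSum n p P Y) (hpn : p ≤ n) :
    2 * p / (n : ℝ) ≤ cumulant P Y 2 := by
  refine le_trans ?_ (h.sum_le_cumulant_two hpn)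
  calc 2 * p / (n : ℝ) = ∑ j ∈ Finset.range p, 2 / (n : ℝ) := by simp; ring
    _ ≤ _ := Finset.sum_le_sum fun j hj => by
      have := Finset.mem_range.1 hj
      have h1 : (0:ℝ) < ((n - j : ℕ) : ℝ) := by exact_mod_cast (by omega : 0 < n - j)
      gcongr
      omega

lemma log_le_cumulant_two (h : IsLogChiSqSum n p P Y) (hpn : p ≤ n) (hn : 1 ≤ n) :
    Real.log (n / (n - p + 1)) ≤ cumulant P Y 2 := by
  refine le_trans ?_ (h.sum_le_cumulant_two hpn)
  have hn0 : (0:ℝ) < n := by exact_mod_cast hn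
  -- With `n + 1` in the numerator the left side is `0` at `q = 0` and grows by `log ((n - q + 1) /
  -- (n - q)) ≤ 1 / (n - q)` at each step.
  have key : ∀ q, q ≤ n → Real.log ((n + 1) / (n - q + 1)) ≤
      ∑ j ∈ Finset.range q, 2 / ((n - j : ℕ) : ℝ) := by
    intro q
    induction q with
    | zero => intro _; simp [div_self (by positivity : (n:ℝ) + 1 ≠ 0)]
    | succ q ih =>
      intro hq
      have h2 : ((n - q : ℕ) : ℝ) = n - q := Nat.cast_sub (by omega)
      have h1 : (0:ℝ) < n - q := by
        rw [← h2]; exact_mod_cast (by omega : 0 < n - q)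
      rw [Finset.sum_range_succ, h2]
      refine le_trans ?_ (add_le_add (ih (by omega)) le_rfl)
      have h3 : ((n:ℝ) + 1) / (n - (q + 1 : ℕ) + 1) =
          (n + 1) / (n - q + 1) * ((n - q + 1) / (n - q)) := by
        push_cast
        rw [show (n:ℝ) - (q + 1) + 1 = n - q by ring]
        field_simp
      rw [h3, Real.log_mul (by positivity) (by positivity)]
      have h4 : Real.log ((n - q + 1) / (n - q)) ≤ 2 / (n - q : ℝ) := by
        refine (Real.log_le_sub_one_of_pos (by positivity)).trans ?_
        rw [div_sub_one h1.ne']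
        gcongr
        linarith
      linarith
  have hp : (0:ℝ) < n - p + 1 := by
    have : (p:ℝ) ≤ n := by exact_mod_cast hpn
    linarith
  refine le_trans (Real.log_le_log (by positivity) ?_) (key p hpn)
  gcongr
  linarith

lemma abs_cumulant_le (h : IsLogChiSqSum n p P Y) (hpn : p ≤ n) (b : ℕ) :
    |cumulant P Y (b + 2)| ≤ (b + 1).factorial * 3 *
      ∑ j ∈ Finset.range p, (2 / ((n - j : ℕ) : ℝ)) ^ (b + 1) := by
  have hx : ∀ j ∈ Finset.range p, (1:ℝ) / 2 ≤ ((n - j : ℕ) : ℝ) / 2 := fun j hj => by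
    have := Finset.mem_range.1 hj
    have : (1:ℝ) ≤ ((n - j : ℕ) : ℝ) := by exact_mod_cast (by omega : 1 ≤ n - j)
    linarith
  rw [h.cumulant_eq hpn, abs_mul, abs_mul, abs_pow, abs_neg, abs_one, one_pow, one_mul,
    Nat.abs_cast, mul_assoc]
  refine mul_le_mul_of_nonneg_left ?_ (by positivity)
  rw [abs_of_nonneg (Finset.sum_nonneg fun j hj => hurwitzSum_nonneg _ (by linarith [hx j hj])),
    Finset.mul_sum]
  refine Finset.sum_le_sum fun j hj => (hurwitzSum_le (hx j hj)).trans (le_of_eq ?_)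
  rw [inv_div]

end IsLogChiSqSum

-- The two quantitative bounds

universe u

/-- All degrees of freedom exceed `(1 - θ) n`, so the cumulant of order `b + 3` is `O(p / n ^ (b +
2))`. The variance is at least `2 p / n`, and the quotient by its power `(b + 3) / 2` is `O((p n) ^
(-(b + 1) / 2))`. -/
theorem exists_momentGap_le_inv_mul {k : ℕ} (hk : Even k) {θ : ℝ} (hθ : θ < 1) :
    ∃ C : ℝ, 0 ≤ C ∧ ∀ n p : ℕ, 1 ≤ p → p ≤ n → (p : ℝ) ≤ θ * n →
      ∀ {Ω : Type u} [MeasurableSpace Ω] (P : Measure Ω) (Y : Ω → ℝ), IsLogChiSqSum n p P Y →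
        momentGap P Y k ≤ C * (1 / ((p : ℝ) * n)) := by
  have hθ' : 0 < 1 - θ := by linarith
  obtain ⟨C, hC0, hC⟩ := exists_moment_bound
    (fun b => (b - 1).factorial * 3 * (2 / (1 - θ)) ^ (b - 1)) (fun b => by positivity) k
  refine ⟨C, hC0, fun n p hp hpn hpθ Ω _ P Y h => ?_⟩
  have := h.isProbabilityMeasure
  have hn1 : 1 ≤ n := hp.trans hpn
  have hn : (0:ℝ) < n := by exact_mod_cast hn1
  have hp0 : (0:ℝ) < p := by exact_mod_cast hp
  have hκ2 := h.le_cumulant_two hpn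
  have hpos : 0 < cumulant P Y 2 := lt_of_lt_of_le (by positivity) hκ2
  set ε : ℝ := (√((p : ℝ) * n))⁻¹ with hε
  have hsq : 0 < √((p : ℝ) * n) := Real.sqrt_pos.2 (by positivity)
  have hε1 : ε ≤ 1 := by
    rw [hε]
    refine inv_le_one_of_one_le₀ ?_
    rw [Real.one_le_sqrt]
    exact_mod_cast Nat.mul_pos hp hn1
  have hε2 : ε ^ 2 = 1 / ((p : ℝ) * n) := by
    rw [hε, inv_pow, Real.sq_sqrt (by positivity), one_div]
  rw [← hε2]
  refine momentGap_le_of_cumulant hk hC h.mem_interior hpos (by positivity) hε1 fun b => ?_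
  have hσ : √(p / n : ℝ) ≤ √(cumulant P Y 2) := by
    refine Real.sqrt_le_sqrt (le_trans ?_ hκ2)
    gcongr
    linarith
  have hterm : ∑ j ∈ Finset.range p, (2 / ((n - j : ℕ) : ℝ)) ^ (b + 2) ≤
      p * (2 / ((1 - θ) * n)) ^ (b + 2) := by
    calc _ ≤ ∑ j ∈ Finset.range p, (2 / ((1 - θ) * n)) ^ (b + 2) := by
          refine Finset.sum_le_sum fun j hj => ?_
          have hj := Finset.mem_range.1 hj
          have h2 : ((n - j : ℕ) : ℝ) = n - j := Nat.cast_sub (by omega)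
          have h3 : (j : ℝ) < p := by exact_mod_cast hj
          have h4 : (1 - θ) * n ≤ ((n - j : ℕ) : ℝ) := by rw [h2]; linarith
          have h5 : 0 < (1 - θ) * n := by positivity
          gcongr
      _ = _ := by simp
  have hscale : (p : ℝ) * (1 / n) ^ (b + 2) ≤ ε ^ (b + 1) * √(cumulant P Y 2) ^ (b + 3) := by
    have e1 : √(p / n : ℝ) = p * ε := by
      rw [← Real.sqrt_sq (by positivity : 0 ≤ p * ε), mul_pow, hε2]
      congr 1
      field_simp
    calc (p : ℝ) * (1 / n) ^ (b + 2) ≤ ε ^ (b + 1) * (p * ε) ^ (b + 3) := by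
          have : ε ^ (b + 1) * (p * ε) ^ (b + 3) = p ^ (b + 3) * (ε ^ 2) ^ (b + 2) := by ring
          rw [this, hε2]
          refine le_of_eq ?_
          rw [one_div, one_div, mul_inv, mul_pow, pow_succ' _ (b + 2), mul_assoc,
            ← mul_assoc (_ ^ (b + 2)), ← mul_pow, mul_inv_cancel₀ hp0.ne', one_pow, one_mul]
      _ ≤ _ := by rw [← e1]; gcongr
  have := h.abs_cumulant_le hpn (b + 1)
  calc |cumulant P Y (b + 3)| ≤ (b + 2).factorial * 3 *
        ∑ j ∈ Finset.range p, (2 / ((n - j : ℕ) : ℝ)) ^ (b + 2) := this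
    _ ≤ (b + 2).factorial * 3 * (p * (2 / ((1 - θ) * n)) ^ (b + 2)) := by gcongr
    _ = (b + 2).factorial * 3 * (2 / (1 - θ)) ^ (b + 2) * (p * (1 / n) ^ (b + 2)) := by
        rw [show 2 / ((1 - θ) * (n:ℝ)) = 2 / (1 - θ) * (1 / n) by field_simp, mul_pow]
        ring
    _ ≤ (b + 2).factorial * 3 * (2 / (1 - θ)) ^ (b + 2) *
        (ε ^ (b + 1) * √(cumulant P Y 2) ^ (b + 3)) := by gcongr
    _ = _ := by simp only [show b + 3 - 1 = b + 2 by omega]; ring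

/-- From order three on, the cumulants involve powers at least `2` of the inverses of the distinct
integers `n - j`, so `∑ 1 / m ^ 2` bounds them uniformly in `n` and `p`, while the variance is at
least `L`. -/
theorem exists_momentGap_le_inv_log {k : ℕ} (hk : Even k) :
    ∃ C : ℝ, 0 ≤ C ∧ ∀ n p : ℕ, 1 ≤ p → p ≤ n → 1 ≤ Real.log ((n : ℝ) / (n - p + 1)) →
      ∀ {Ω : Type u} [MeasurableSpace Ω] (P : Measure Ω) (Y : Ω → ℝ), IsLogChiSqSum n p P Y →
        momentGap P Y k ≤ C * (1 / Real.log ((n : ℝ) / (n - p + 1))) := by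
  have hsum : Summable fun m : ℕ => ((m : ℝ) ^ 2)⁻¹ := Real.summable_nat_pow_inv.2 one_lt_two
  set S : ℝ := ∑' m : ℕ, ((m : ℝ) ^ 2)⁻¹ with hS
  have hS0 : 0 ≤ S := tsum_nonneg fun m => by positivity
  obtain ⟨C, hC0, hC⟩ := exists_moment_bound
    (fun b => (b - 1).factorial * 3 * (2 ^ (b - 1) * S)) (fun b => by positivity) k
  refine ⟨C, hC0, fun n p hp hpn hlog Ω _ P Y h => ?_⟩
  have := h.isProbabilityMeasure
  have hn1 : 1 ≤ n := hp.trans hpn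
  set L := Real.log ((n : ℝ) / (n - p + 1)) with hL
  have hκ2 : L ≤ cumulant P Y 2 := h.log_le_cumulant_two hpn hn1
  have hL0 : 0 < L := by linarith
  have hpos : 0 < cumulant P Y 2 := by linarith
  set ε : ℝ := (√L)⁻¹ with hε
  have hsq : 0 < √L := Real.sqrt_pos.2 hL0
  have hε1 : ε ≤ 1 := by
    rw [hε]
    refine inv_le_one_of_one_le₀ ?_
    rwa [Real.one_le_sqrt]
  have hε2 : ε ^ 2 = 1 / L := by
    rw [hε, inv_pow, Real.sq_sqrt hL0.le, one_div]
  rw [← hε2]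
  refine momentGap_le_of_cumulant hk hC h.mem_interior hpos (by positivity) hε1 fun b => ?_
  have hterm : ∑ j ∈ Finset.range p, (2 / ((n - j : ℕ) : ℝ)) ^ (b + 2) ≤ 2 ^ (b + 2) * S := by
    calc _ ≤ ∑ j ∈ Finset.range p, 2 ^ (b + 2) * (((n - j : ℕ) : ℝ) ^ 2)⁻¹ := by
          refine Finset.sum_le_sum fun j hj => ?_
          have hj := Finset.mem_range.1 hj
          have h1 : (1:ℝ) ≤ ((n - j : ℕ) : ℝ) := by exact_mod_cast (by omega : 1 ≤ n - j)
          rw [div_pow, div_eq_mul_inv]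
          gcongr
          omega
      _ = 2 ^ (b + 2) * ∑ j ∈ Finset.range p, (((n - j : ℕ) : ℝ) ^ 2)⁻¹ := by
          rw [Finset.mul_sum]
      _ ≤ _ := by
          gcongr
          have hinj : Set.InjOn (fun j => n - j) (Finset.range p) := by
            intro i hi j hj hij
            have hi := Finset.mem_range.1 hi
            have hj := Finset.mem_range.1 hj
            simp only at hij
            omega
          rw [← Finset.sum_image (f := fun m : ℕ => ((m : ℝ) ^ 2)⁻¹) hinj]
          exact hsum.sum_le_tsum _ fun m _ => by positivity
  -- Since `ε = L ^ (-1/2)`, the product is at least `L`, and `L ≥ 1`.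
  have hscale : 1 ≤ ε ^ (b + 1) * √(cumulant P Y 2) ^ (b + 3) := by
    have hσ : √L ≤ √(cumulant P Y 2) := Real.sqrt_le_sqrt hκ2
    calc (1:ℝ) ≤ √L ^ 2 := by rwa [Real.sq_sqrt hL0.le]
      _ = ε ^ (b + 1) * √L ^ (b + 3) := by
          rw [hε, show b + 3 = (b + 1) + 2 by ring, pow_add (√L) (b + 1), ← mul_assoc, ← mul_pow,
            inv_mul_cancel₀ hsq.ne', one_pow, one_mul]
      _ ≤ _ := by gcongr
  have := h.abs_cumulant_le hpn (b + 1)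
  calc |cumulant P Y (b + 3)| ≤ (b + 2).factorial * 3 *
        ∑ j ∈ Finset.range p, (2 / ((n - j : ℕ) : ℝ)) ^ (b + 2) := this
    _ ≤ (b + 2).factorial * 3 * (2 ^ (b + 2) * S) * 1 := by rw [mul_one]; gcongr
    _ ≤ (b + 2).factorial * 3 * (2 ^ (b + 2) * S) *
        (ε ^ (b + 1) * √(cumulant P Y 2) ^ (b + 3)) := by gcongr
    _ = _ := by simp only [show b + 3 - 1 = b + 2 by omega]; ring

lemma IsLogChiSqSum.standardizable {Ω : Type*} [MeasurableSpace Ω] {n p : ℕ} {P : Measure Ω}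
    {Y : Ω → ℝ} (h : IsLogChiSqSum n p P Y) (hp : 1 ≤ p) (hpn : p ≤ n) : Standardizable P Y := by
  have := h.isProbabilityMeasure
  refine ⟨fun m => integrable_pow_of_mem_interior_integrableExpSet h.mem_interior m, ?_⟩
  rw [← cumulant_two h.mem_interior]
  have hn : (0:ℝ) < n := by exact_mod_cast hp.trans hpn
  have hp0 : (0:ℝ) < p := by exact_mod_cast hp
  exact lt_of_lt_of_le (by positivity) (h.le_cumulant_two hpn)

/-! ### Gram determinants: base times height -/

section Gram

variable {E : Type*} [NormedAddCommGroup E] [InnerProductSpace ℝ E]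

lemma gram_sum_smul {ι κ : Type*} [Fintype κ] (T : Matrix ι κ ℝ) (z : κ → E) :
    Matrix.gram ℝ (fun i => ∑ j, T i j • z j) = T * Matrix.gram ℝ z * T.transpose := by
  ext i j
  simp only [Matrix.gram_apply, sum_inner, inner_sum, Matrix.mul_apply, Matrix.transpose_apply,
    real_inner_smul_left, real_inner_smul_right, Finset.sum_mul]
  refine Finset.sum_congr rfl fun a _ => Finset.sum_congr rfl fun b _ => ?_
  rw [real_inner_comm]
  ring

lemma det_gram_cons_of_orthogonal {p : ℕ} {w : E} {x : Fin p → E}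
    (h : ∀ i, inner ℝ w (x i) = 0) :
    (Matrix.gram ℝ (Fin.cons w x : Fin (p + 1) → E)).det = ‖w‖ ^ 2 * (Matrix.gram ℝ x).det := by
  rw [Matrix.det_succ_row_zero, Fin.sum_univ_succ, Finset.sum_eq_zero]
  · simp only [Fin.val_zero, pow_zero, one_mul, Matrix.gram_apply, Fin.cons_zero, add_zero,
      real_inner_self_eq_norm_sq]
    congr 2
  · intro i _
    simp [h]

/-- The change of vectors is given by a unitriangular matrix `T`, and Gram matrices transform as `T
G Tᵀ`. -/
lemma det_gram_cons_add_sum {p : ℕ} (w : E) (x : Fin p → E) (c : Fin p → ℝ) :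
    (Matrix.gram ℝ (Fin.cons (w + ∑ i, c i • x i) x : Fin (p + 1) → E)).det =
      (Matrix.gram ℝ (Fin.cons w x : Fin (p + 1) → E)).det := by
  let T : Matrix (Fin (p + 1)) (Fin (p + 1)) ℝ :=
    Matrix.of (Fin.cons (Fin.cons 1 c) fun i => Fin.cons 0 (Pi.single i 1))
  have hT : T.det = 1 := by
    rw [Matrix.det_of_isUpperTriangular]
    · refine Finset.prod_eq_one fun i _ => ?_
      refine Fin.cases ?_ (fun i => ?_) i <;> simp [T]
    · intro i j hij
      have hij : j < i := hij
      obtain ⟨i, rfl⟩ := Fin.exists_succ_eq.2 (Fin.ne_zero_of_lt hij)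
      refine Fin.cases (fun _ => by simp [T]) (fun j hij => ?_) j hij
      have : j ≠ i := (Fin.succ_lt_succ_iff.1 hij).ne
      simp [T, this]
  have hz : (Fin.cons (w + ∑ i, c i • x i) x : Fin (p + 1) → E) =
      fun i => ∑ j, T i j • (Fin.cons w x : Fin (p + 1) → E) j := by
    ext i
    refine Fin.cases ?_ (fun i => ?_) i
    · simp [T, Fin.sum_univ_succ]
    · simp [T, Fin.sum_univ_succ, Pi.single_apply, ite_smul]
  rw [hz, gram_sum_smul, Matrix.det_mul, Matrix.det_mul, Matrix.det_transpose, hT, one_mul,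
    mul_one]

lemma det_gram_cons [FiniteDimensional ℝ E] {p : ℕ} (y : E) (x : Fin p → E) :
    (Matrix.gram ℝ (Fin.cons y x : Fin (p + 1) → E)).det =
      ‖(Submodule.span ℝ (Set.range x))ᗮ.orthogonalProjectionOnto y‖ ^ 2 *
        (Matrix.gram ℝ x).det := by
  set K := Submodule.span ℝ (Set.range x)
  obtain ⟨c, hc⟩ := (Submodule.mem_span_range_iff_exists_fun ℝ).1 (K.starProjection_apply_mem y)
  have hy : y = Kᗮ.starProjection y + ∑ i, c i • x i := by
    rw [hc, add_comm, Submodule.starProjection_add_starProjection_orthogonal]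
  conv_lhs => rw [hy]
  rw [det_gram_cons_add_sum, det_gram_cons_of_orthogonal]
  · rfl
  · intro i
    exact Submodule.inner_left_of_mem_orthogonal (K := K)
      (Submodule.subset_span (Set.mem_range_self i)) (Kᗮ.starProjection_apply_mem y)

lemma continuous_det_gram {p : ℕ} : Continuous fun x : Fin p → E => (Matrix.gram ℝ x).det := by
  refine Continuous.matrix_det (continuous_matrix fun i j => ?_)
  simp only [Matrix.gram_apply]
  fun_prop

end Gram

/-! ### The standard Gaussian measure and the moments of its norm -/

/-- The density of the standard Gaussian measure. -/
def stdGaussianDensity (E : Type*) [NormedAddCommGroup E] [InnerProductSpace ℝ E] (x : E) : ℝ :=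
  ((2 * Real.pi) ^ (Module.finrank ℝ E / 2 : ℝ))⁻¹ * Real.exp (-(1 / 2) * ‖x‖ ^ 2)

lemma stdGaussianDensity_nonneg {E : Type*} [NormedAddCommGroup E] [InnerProductSpace ℝ E]
    (x : E) : 0 ≤ stdGaussianDensity E x := by
  unfold stdGaussianDensity; positivity

section StdGaussian

variable {E : Type*} [NormedAddCommGroup E] [InnerProductSpace ℝ E] [FiniteDimensional ℝ E]
  [MeasurableSpace E] [BorelSpace E]

lemma stdGaussian_map_orthogonalProjectionOnto (K : Submodule ℝ E) :
    (stdGaussian E).map K.orthogonalProjectionOnto = stdGaussian K := by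
  have : IsProbabilityMeasure ((stdGaussian E).map K.orthogonalProjectionOnto) :=
    Measure.isProbabilityMeasure_map (by fun_prop)
  refine Measure.ext_of_charFun ?_
  ext t
  rw [charFun_stdGaussian, charFun_apply, integral_map (by fun_prop) (by fun_prop)]
  simp_rw [Submodule.inner_orthogonalProjectionOnto_eq_of_mem_right]
  rw [← charFun_apply, charFun_stdGaussian]
  rfl

lemma integrable_stdGaussianDensity : Integrable (stdGaussianDensity E) := by
  have h := GaussianFourier.integral_rexp_neg_mul_sq_norm (V := E) (b := 1 / 2) (by norm_num)
  have : Integrable fun x : E => Real.exp (-(1 / 2) * ‖x‖ ^ 2) := by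
    refine Integrable.of_integral_ne_zero ?_
    rw [h]
    positivity
  exact this.const_mul _

lemma stdGaussian_eq_withDensity :
    stdGaussian E = volume.withDensity fun x => ENNReal.ofReal (stdGaussianDensity E x) := by
  have : IsFiniteMeasure (volume.withDensity fun x => ENNReal.ofReal (stdGaussianDensity E x)) :=
    isFiniteMeasure_withDensity_ofReal integrable_stdGaussianDensity.2
  refine Measure.ext_of_charFun ?_
  ext t
  have hmeas : Measurable fun x => ENNReal.ofReal (stdGaussianDensity E x) := by
    unfold stdGaussianDensity; fun_prop
  rw [charFun_stdGaussian, charFun_apply,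
    integral_withDensity_eq_integral_toReal_smul hmeas (by simp)]
  have h := GaussianFourier.integral_cexp_neg_mul_sq_norm_add (V := E) (b := 1 / 2) (by norm_num)
    Complex.I t
  have h2 : ∀ x : E, (ENNReal.ofReal (stdGaussianDensity E x)).toReal •
      Complex.exp (inner ℝ x t * Complex.I) =
      ((((2 * Real.pi) ^ (Module.finrank ℝ E / 2 : ℝ))⁻¹ : ℝ) : ℂ) *
        Complex.exp (-(1 / 2) * ‖x‖ ^ 2 + Complex.I * inner ℝ t x) := by
    intro x
    rw [ENNReal.toReal_ofReal (stdGaussianDensity_nonneg x), stdGaussianDensity,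
      Complex.real_smul, Complex.exp_add, real_inner_comm]
    push_cast
    ring_nf
  simp_rw [h2]
  rw [integral_const_mul, h]
  have hc : ((((2 * Real.pi) ^ (Module.finrank ℝ E / 2 : ℝ))⁻¹ : ℝ) : ℂ) *
      (Real.pi / (1 / 2 : ℂ)) ^ (Module.finrank ℝ E / 2 : ℂ) = 1 := by
    have : (Real.pi / (1 / 2 : ℂ)) ^ (Module.finrank ℝ E / 2 : ℂ) =
        (((2 * Real.pi) ^ (Module.finrank ℝ E / 2 : ℝ) : ℝ) : ℂ) := by
      rw [Complex.ofReal_cpow (by positivity)]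
      push_cast
      congr 1
      field_simp
    rw [this, ← Complex.ofReal_mul, inv_mul_cancel₀ (by positivity), Complex.ofReal_one]
  rw [← mul_assoc, hc, one_mul]
  congr 1
  rw [Complex.I_sq]
  ring

lemma ae_ne_zero_stdGaussian [Nontrivial E] : ∀ᵐ x ∂(stdGaussian E), x ≠ 0 := by
  rw [stdGaussian_eq_withDensity]
  exact (withDensity_absolutelyContinuous _ _).ae_le (Measure.ae_ne volume 0)

lemma integral_exp_log_norm_sq_stdGaussian [Nontrivial E] {s : ℝ}
    (hs : -(Module.finrank ℝ E / 2 : ℝ) < s) :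
    ∫ x, Real.exp (s * Real.log (‖x‖ ^ 2)) ∂(stdGaussian E) =
      2 ^ s * Real.Gamma (Module.finrank ℝ E / 2 + s) / Real.Gamma (Module.finrank ℝ E / 2) := by
  have hd : 0 < Module.finrank ℝ E := Module.finrank_pos
  have hd' : (0:ℝ) < Module.finrank ℝ E := by exact_mod_cast hd
  have hmeas : Measurable fun x => ENNReal.ofReal (stdGaussianDensity E x) := by
    unfold stdGaussianDensity; fun_prop
  -- Polar coordinates give the Gamma factor up to a constant `Z` independent of `s`. The case `s =
  -- 0`, where the integral is `1`, then determines `Z` without the volume of the unit ball.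
  obtain ⟨Z, hZ⟩ : ∃ Z : ℝ, ∀ s : ℝ, -(Module.finrank ℝ E / 2 : ℝ) < s →
      ∫ x, Real.exp (s * Real.log (‖x‖ ^ 2)) ∂(stdGaussian E) =
        Z * (2 ^ s * Real.Gamma (Module.finrank ℝ E / 2 + s)) := by
    refine ⟨((2 * Real.pi) ^ (Module.finrank ℝ E / 2 : ℝ))⁻¹ * (Module.finrank ℝ E *
      (volume : Measure E).real (Metric.ball 0 1)) *
      (2 ^ (Module.finrank ℝ E / 2 : ℝ) * (1 / 2)), fun s hs => ?_⟩
    rw [stdGaussian_eq_withDensity, integral_withDensity_eq_integral_toReal_smul hmeas (by simp)]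
    have h1 : ∀ x : E, (ENNReal.ofReal (stdGaussianDensity E x)).toReal •
        Real.exp (s * Real.log (‖x‖ ^ 2)) =
        ((2 * Real.pi) ^ (Module.finrank ℝ E / 2 : ℝ))⁻¹ *
          (fun r : ℝ => Real.exp (s * Real.log (r ^ 2)) * Real.exp (-(1 / 2) * r ^ 2)) ‖x‖ := by
      intro x
      rw [ENNReal.toReal_ofReal (stdGaussianDensity_nonneg x), stdGaussianDensity, smul_eq_mul]
      ring
    simp_rw [h1]
    rw [integral_const_mul, integral_fun_norm_addHaar volume
      fun r : ℝ => Real.exp (s * Real.log (r ^ 2)) * Real.exp (-(1 / 2) * r ^ 2)]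
    have h2 : ∫ r in Set.Ioi (0:ℝ), r ^ (Module.finrank ℝ E - 1) •
        (Real.exp (s * Real.log (r ^ 2)) * Real.exp (-(1 / 2) * r ^ 2)) =
        ∫ r in Set.Ioi (0:ℝ), r ^ (Module.finrank ℝ E - 1 + 2 * s : ℝ) *
          Real.exp (-(1 / 2) * r ^ (2:ℝ)) := by
      refine setIntegral_congr_fun measurableSet_Ioi fun r hr => ?_
      have hr : 0 < r := hr
      simp only [smul_eq_mul]
      rw [Real.rpow_add hr, ← mul_assoc, Real.rpow_two]
      congr 2
      · rw [← Real.rpow_natCast, Nat.cast_sub hd, Nat.cast_one]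
      · rw [Real.log_pow, Real.rpow_def_of_pos hr]
        congr 1
        push_cast
        ring
    rw [h2, integral_rpow_mul_exp_neg_mul_rpow two_pos (by linarith) (by norm_num)]
    rw [show ((Module.finrank ℝ E : ℝ) - 1 + 2 * s + 1) / 2 = Module.finrank ℝ E / 2 + s by ring,
      show -((Module.finrank ℝ E : ℝ) - 1 + 2 * s + 1) / 2 = -(Module.finrank ℝ E / 2 + s) by ring,
      one_div, Real.inv_rpow zero_le_two, Real.rpow_neg zero_le_two, inv_inv,
      Real.rpow_add two_pos]
    simp only [nsmul_eq_mul, smul_eq_mul]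
    ring
  have h0 := hZ 0 (by linarith)
  simp only [zero_mul, Real.exp_zero, integral_const, probReal_univ, smul_eq_mul, mul_one,
    Real.rpow_zero, add_zero, one_mul] at h0
  have hG : Real.Gamma (Module.finrank ℝ E / 2) ≠ 0 := (Real.Gamma_pos_of_pos (by positivity)).ne'
  rw [hZ s hs, eq_div_iff hG]
  linear_combination (-(2 ^ s * Real.Gamma (Module.finrank ℝ E / 2 + s))) * h0

lemma lintegral_exp_log_norm_sq_stdGaussian [Nontrivial E] {s : ℝ}
    (hs : -(Module.finrank ℝ E / 2 : ℝ) < s) :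
    ∫⁻ x, ENNReal.ofReal (Real.exp (s * Real.log (‖x‖ ^ 2))) ∂(stdGaussian E) =
      ENNReal.ofReal (2 ^ s * Real.Gamma (Module.finrank ℝ E / 2 + s) /
        Real.Gamma (Module.finrank ℝ E / 2)) := by
  have h := integral_exp_log_norm_sq_stdGaussian hs
  have hd : (0:ℝ) < Module.finrank ℝ E := by exact_mod_cast Module.finrank_pos
  have hG : 0 < Real.Gamma (Module.finrank ℝ E / 2) := Real.Gamma_pos_of_pos (by positivity)
  have hG' : 0 < Real.Gamma (Module.finrank ℝ E / 2 + s) :=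
    Real.Gamma_pos_of_pos (by linarith)
  rw [← h, ofReal_integral_eq_lintegral_ofReal]
  · refine Integrable.of_integral_ne_zero ?_
    rw [h]
    positivity
  · exact .of_forall fun x => (Real.exp_pos _).le

/-! ### The moment generating function of the log Gram determinant -/

variable (E) in
/-- The law of `p` independent standard Gaussian points in `E`. -/
abbrev stdGaussianPi (p : ℕ) : Measure (Fin p → E) := Measure.pi fun _ => stdGaussian E

/-- The logarithm of the Gram determinant. -/
def logDetGram {p : ℕ} (x : Fin p → E) : ℝ := Real.log (Matrix.gram ℝ x).det

lemma measurable_logDetGram {p : ℕ} : Measurable (logDetGram : (Fin p → E) → ℝ) :=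
  Real.measurable_log.comp continuous_det_gram.measurable

lemma measurePreserving_cons (p : ℕ) :
    MeasurePreserving (fun z : E × (Fin p → E) => (Fin.cons z.1 z.2 : Fin (p + 1) → E))
      ((stdGaussian E).prod (stdGaussianPi E p)) (stdGaussianPi E (p + 1)) := by
  have h := (measurePreserving_piFinSuccAbove (fun _ : Fin (p + 1) => stdGaussian E) 0).symm
  have h2 : ⇑(MeasurableEquiv.piFinSuccAbove (fun _ : Fin (p + 1) => E) 0).symm =
      fun z : E × (Fin p → E) => (Fin.cons z.1 z.2 : Fin (p + 1) → E) := by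
    ext1 z
    simp
    rfl
  rw [h2] at h
  exact h

lemma lintegral_orthogonalProjectionOnto_stdGaussian (K : Submodule ℝ E)
    {f : K → ENNReal} (hf : Measurable f) :
    ∫⁻ y, f (K.orthogonalProjectionOnto y) ∂(stdGaussian E) = ∫⁻ z, f z ∂(stdGaussian K) := by
  rw [← stdGaussian_map_orthogonalProjectionOnto, lintegral_map hf (by fun_prop)]

/-- With `x` fixed and independent, the new factor is the squared norm of the projection of `y` to a
space of dimension `finrank E - p`, where the projection is again standard Gaussian. -/
lemma ae_det_gram_cons_ne_zero {p : ℕ} {x : Fin p → E} (hx : (Matrix.gram ℝ x).det ≠ 0)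
    (hp : p < Module.finrank ℝ E) :
    (∀ᵐ y ∂(stdGaussian E), (Matrix.gram ℝ (Fin.cons y x : Fin (p + 1) → E)).det ≠ 0) ∧
    ∀ s : ℝ, -(1 / 2) < s →
      ∫⁻ y, ENNReal.ofReal (Real.exp (s * logDetGram (Fin.cons y x : Fin (p + 1) → E)))
        ∂(stdGaussian E) = ENNReal.ofReal (2 ^ s *
          Real.Gamma (((Module.finrank ℝ E - p : ℕ) : ℝ) / 2 + s) /
          Real.Gamma (((Module.finrank ℝ E - p : ℕ) : ℝ) / 2)) *
        ENNReal.ofReal (Real.exp (s * logDetGram x)) := by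
  set K := (Submodule.span ℝ (Set.range x))ᗮ with hK
  have hli := Matrix.linearIndependent_of_det_gram_ne_zero hx
  have hfin : Module.finrank ℝ K = Module.finrank ℝ E - p := by
    have h1 := Submodule.finrank_add_finrank_orthogonal (Submodule.span ℝ (Set.range x))
    rw [finrank_span_eq_card hli, Fintype.card_fin, ← hK] at h1
    omega
  have hK0 : 0 < Module.finrank ℝ K := by omega
  have hK1 : (1:ℝ) ≤ Module.finrank ℝ K := by exact_mod_cast hK0
  have : Nontrivial K := Module.finrank_pos_iff.1 hK0
  have hae : ∀ᵐ y ∂(stdGaussian E), K.orthogonalProjectionOnto y ≠ 0 := by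
    have h := ae_ne_zero_stdGaussian (E := K)
    rw [← stdGaussian_map_orthogonalProjectionOnto] at h
    exact ae_of_ae_map (p := fun z : K => z ≠ 0) (by fun_prop) h
  refine ⟨?_, fun s hs => ?_⟩
  · filter_upwards [hae] with y hy
    rw [det_gram_cons]
    exact mul_ne_zero (pow_ne_zero _ (norm_ne_zero_iff.2 hy)) hx
  · rw [← hfin, ← lintegral_exp_log_norm_sq_stdGaussian (E := K) (by linarith),
      ← lintegral_orthogonalProjectionOnto_stdGaussian K
        (f := fun z => ENNReal.ofReal (Real.exp (s * Real.log (‖z‖ ^ 2)))) (by fun_prop),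
      ← lintegral_mul_const _ (by fun_prop)]
    refine lintegral_congr_ae ?_
    filter_upwards [hae] with y hy
    rw [logDetGram, det_gram_cons, Real.log_mul (pow_ne_zero _ (norm_ne_zero_iff.2 hy)) hx,
      mul_add, Real.exp_add, ENNReal.ofReal_mul (Real.exp_pos _).le]
    rfl

lemma ae_det_gram_ne_zero {p : ℕ} (hp : p ≤ Module.finrank ℝ E) :
    ∀ᵐ x ∂(stdGaussianPi E p), (Matrix.gram ℝ x).det ≠ 0 := by
  induction p with
  | zero => simp
  | succ p ih =>
    have hm : ∀ q, MeasurableSet {x : Fin q → E | (Matrix.gram ℝ x).det ≠ 0} := fun q =>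
      (measurableSet_eq_fun continuous_det_gram.measurable measurable_const).compl
    have hc := measurePreserving_cons (E := E) p
    have hm' : MeasurableSet {z : E × (Fin p → E) |
        (Matrix.gram ℝ (Fin.cons z.1 z.2 : Fin (p + 1) → E)).det ≠ 0} := hc.measurable (hm _)
    rw [← hc.map_eq, ae_map_iff hc.measurable.aemeasurable (hm _),
      Measure.ae_prod_iff_ae_ae hm', Measure.ae_ae_comm hm']
    filter_upwards [ih (by omega)] with x hx using (ae_det_gram_cons_ne_zero hx (by omega)).1

lemma lintegral_exp_logDetGram {p : ℕ} (hp : p ≤ Module.finrank ℝ E) {s : ℝ} (hs : -(1 / 2) < s) :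
    ∫⁻ x, ENNReal.ofReal (Real.exp (s * logDetGram x)) ∂(stdGaussianPi E p) =
      ENNReal.ofReal (∏ j ∈ Finset.range p, (2 ^ s *
        Real.Gamma (((Module.finrank ℝ E - j : ℕ) : ℝ) / 2 + s) /
          Real.Gamma (((Module.finrank ℝ E - j : ℕ) : ℝ) / 2))) := by
  induction p with
  | zero => simp [logDetGram]
  | succ p ih =>
    have hc := measurePreserving_cons (E := E) p
    have hmeas : ∀ q, Measurable fun x : Fin q → E =>
        ENNReal.ofReal (Real.exp (s * logDetGram x)) := fun q =>
      ((measurable_logDetGram.const_mul s).exp).ennreal_ofReal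
    have hmeas' : Measurable fun z : E × (Fin p → E) => ENNReal.ofReal
        (Real.exp (s * logDetGram (Fin.cons z.1 z.2 : Fin (p + 1) → E))) :=
      (hmeas _).comp hc.measurable
    -- The new vector is integrated first, with the old ones fixed.
    rw [← hc.lintegral_comp (hmeas _), lintegral_prod_symm _ hmeas'.aemeasurable,
      Finset.prod_range_succ, mul_comm]
    have hj : (1:ℝ) ≤ ((Module.finrank ℝ E - p : ℕ) : ℝ) := by
      exact_mod_cast (by omega : 1 ≤ Module.finrank ℝ E - p)
    have hG := Real.Gamma_pos_of_pos
      (show 0 < ((Module.finrank ℝ E - p : ℕ) : ℝ) / 2 + s by linarith)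
    have hG' := Real.Gamma_pos_of_pos
      (show 0 < ((Module.finrank ℝ E - p : ℕ) : ℝ) / 2 by linarith)
    rw [ENNReal.ofReal_mul (by positivity), ← ih (by omega), ← lintegral_const_mul _ (hmeas _)]
    refine lintegral_congr_ae ?_
    filter_upwards [ae_det_gram_ne_zero (E := E) (p := p) (by omega)] with x hx
      using (ae_det_gram_cons_ne_zero hx (by omega)).2 s hs

theorem isLogChiSqSum_logDetGram {p : ℕ} (hp : p ≤ Module.finrank ℝ E) :
    IsLogChiSqSum (Module.finrank ℝ E) p (stdGaussianPi E p) logDetGram := by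
  have hmeas : ∀ s : ℝ, Measurable fun x : Fin p → E => Real.exp (s * logDetGram x) :=
    fun s => (measurable_logDetGram.const_mul s).exp
  refine ⟨inferInstance, fun s hs => ?_, fun s hs => ?_⟩
  · rw [← lintegral_ofReal_ne_top_iff_integrable (hmeas s).aestronglyMeasurable
      (.of_forall fun x => (Real.exp_pos _).le), lintegral_exp_logDetGram hp hs]
    exact ENNReal.ofReal_ne_top
  · rw [mgf, integral_eq_lintegral_of_nonneg_ae (.of_forall fun x => (Real.exp_pos _).le)
      (hmeas s).aestronglyMeasurable, lintegral_exp_logDetGram hp hs, ENNReal.toReal_ofReal]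
    refine Finset.prod_nonneg fun j hj => ?_
    have hj := Finset.mem_range.1 hj
    have hj : (1:ℝ) ≤ ((Module.finrank ℝ E - j : ℕ) : ℝ) := by
      exact_mod_cast (by omega : 1 ≤ Module.finrank ℝ E - j)
    have hG := Real.Gamma_pos_of_pos
      (show 0 < ((Module.finrank ℝ E - j : ℕ) : ℝ) / 2 + s by linarith)
    have hG' := Real.Gamma_pos_of_pos
      (show 0 < ((Module.finrank ℝ E - j : ℕ) : ℝ) / 2 by linarith)
    positivity

end StdGaussian

/-! ### Invariance under positive affine changes -/

section Affine

variable {Ω Ω' : Type*} [MeasurableSpace Ω] [MeasurableSpace Ω'] {P : Measure Ω} {Q : Measure Ω'}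
  [IsProbabilityMeasure P]
  {X : Ω → ℝ} {Y : Ω' → ℝ} {f : Ω → Ω'} {a b : ℝ}

lemma variance_of_ae_eq_affine (hf : MeasurePreserving f P Q) (hY : Measurable Y)
    (hX : X =ᵐ[P] fun ω => a * Y (f ω) + b) : Var[X; P] = a ^ 2 * Var[Y; Q] := by
  have hm : Measurable fun ω => Y (f ω) := hY.comp hf.measurable
  rw [variance_congr hX, variance_add_const (hm.const_mul a).aestronglyMeasurable,
    variance_const_mul, ← hf.map_eq, variance_map hY.aemeasurable hf.measurable.aemeasurable]
  rfl

lemma Standardizable.of_ae_eq_affine (h : Standardizable Q Y) (hf : MeasurePreserving f P Q)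
    (hY : Measurable Y) (ha : 0 < a) (hX : X =ᵐ[P] fun ω => a * Y (f ω) + b) :
    Standardizable P X := by
  refine ⟨fun m => ?_, ?_⟩
  · have h1 : Integrable (fun ω' => (a * Y ω' + b) ^ m) Q := by
      simp only [add_pow, mul_pow]
      exact integrable_finsetSum _ fun i _ =>
        (((h.1 i).const_mul (a ^ i)).mul_const _).mul_const _
    refine (hf.integrable_comp_of_integrable h1).congr ?_
    filter_upwards [hX] with ω hω
    simp [hω]
  · rw [variance_of_ae_eq_affine hf hY hX]
    exact mul_pos (by positivity) h.2

lemma momentGap_of_ae_eq_affine (h : Standardizable Q Y) (hf : MeasurePreserving f P Q)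
    (hY : Measurable Y) (ha : 0 < a) (hX : X =ᵐ[P] fun ω => a * Y (f ω) + b) (k : ℕ) :
    momentGap P X k = momentGap Q Y k := by
  have hint : Integrable Y Q := by simpa using h.1 1
  have hmean : ∫ ω, X ω ∂P = a * ∫ ω, Y ω ∂Q + b := by
    have h1 : ∫ ω, Y (f ω) ∂P = ∫ ω, Y ω ∂Q := by
      rw [← hf.map_eq, integral_map hf.measurable.aemeasurable hY.aestronglyMeasurable]
    have h2 : Integrable (fun ω => Y (f ω)) P := hf.integrable_comp_of_integrable hint
    rw [integral_congr_ae hX, integral_add (h2.const_mul a) (integrable_const b),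
      integral_const_mul, h1]
    simp
  have hst : standardize P X =ᵐ[P] fun ω => standardize Q Y (f ω) := by
    filter_upwards [hX] with ω hω
    have hσ : 0 < √(Var[Y; Q]) := Real.sqrt_pos.2 h.2
    rw [standardize, standardize, hω, hmean, variance_of_ae_eq_affine hf hY hX,
      Real.sqrt_mul (by positivity), Real.sqrt_sq ha.le]
    field_simp
    ring
  have hm : Measurable fun ω' => standardize Q Y ω' ^ k := by
    unfold standardize
    fun_prop
  rw [momentGap, momentGap]
  congr 2
  calc ∫ ω, standardize P X ω ^ k ∂P = ∫ ω, standardize Q Y (f ω) ^ k ∂P := by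
        refine integral_congr_ae ?_
        filter_upwards [hst] with ω hω
        rw [hω]
    _ = _ := by
        rw [← integral_map (φ := f) (f := fun ω' => standardize Q Y ω' ^ k)
          hf.measurable.aemeasurable hm.aestronglyMeasurable, hf.map_eq]

end Affine

/-! ### Columns of a Gaussian matrix as Gaussian points -/

section Transpose

lemma measurePreserving_curry_pi {ι κ α : Type*} [Fintype ι] [Fintype κ] [MeasurableSpace α]
    (μ : Measure α) [IsProbabilityMeasure μ] :
    MeasurePreserving (MeasurableEquiv.curry ι κ α) (Measure.pi fun _ => μ)
      (Measure.pi fun _ => Measure.pi fun _ => μ) := by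
  refine ⟨MeasurableEquiv.measurable _, ?_⟩
  have := Measure.infinitePi_map_curry (ι := ι) (κ := κ) fun _ _ => μ
  simpa only [Measure.infinitePi_eq_pi] using this

lemma measurePreserving_swap_pi {ι κ α : Type*} [Fintype ι] [Fintype κ] [MeasurableSpace α]
    (μ : Measure α) [IsProbabilityMeasure μ] :
    MeasurePreserving (fun (A : ι → κ → α) j i => A i j)
      (Measure.pi fun _ => Measure.pi fun _ => μ) (Measure.pi fun _ => Measure.pi fun _ => μ) :=
  ((measurePreserving_curry_pi μ).comp (measurePreserving_piCongrLeft (fun _ : κ × ι => μ)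
    (Equiv.prodComm ι κ))).comp (measurePreserving_curry_pi μ).symm

lemma measurePreserving_toLp_transpose (n p : ℕ) :
    MeasurePreserving (fun (A : Fin n → Fin p → ℝ) (j : Fin p) =>
      (WithLp.toLp 2 fun i => A i j : EuclideanSpace ℝ (Fin n)))
      (gaussianMatrix n p) (stdGaussianPi (EuclideanSpace ℝ (Fin n)) p) := by
  have h2 : MeasurePreserving (fun (B : Fin p → Fin n → ℝ) (j : Fin p) =>
      (WithLp.toLp 2 (B j) : EuclideanSpace ℝ (Fin n)))
      (Measure.pi fun _ => Measure.pi fun _ => gaussianReal 0 1)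
      (stdGaussianPi (EuclideanSpace ℝ (Fin n)) p) :=
    measurePreserving_pi _ _ fun _ => ⟨by fun_prop, map_pi_eq_stdGaussian⟩
  exact h2.comp (measurePreserving_swap_pi (gaussianReal 0 1))

lemma det_laguerreMatrix {n p : ℕ} (A : Fin n → Fin p → ℝ) :
    (laguerreMatrix A).det = (Matrix.gram ℝ fun j : Fin p =>
      (WithLp.toLp 2 fun i => A i j : EuclideanSpace ℝ (Fin n))).det := by
  congr 1
  ext i j
  simp [laguerreMatrix, Matrix.mul_apply, PiLp.inner_apply, mul_comm]

end Transpose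

/-! ### Volumes as Gram determinants -/

section Volume

variable {n p : ℕ}

/-- The linear map sending the standard basis of `ℝᵖ` to given vectors. -/
def linearMapOfVectors (x : Fin p → EuclideanSpace ℝ (Fin n)) :
    EuclideanSpace ℝ (Fin p) →ₗ[ℝ] EuclideanSpace ℝ (Fin n) :=
  (EuclideanSpace.basisFun (Fin p) ℝ).toBasis.constr ℝ x

lemma linearMapOfVectors_basisFun (x : Fin p → EuclideanSpace ℝ (Fin n)) (i : Fin p) :
    linearMapOfVectors x (EuclideanSpace.basisFun (Fin p) ℝ i) = x i := by
  have := (EuclideanSpace.basisFun (Fin p) ℝ).toBasis.constr_basis ℝ x i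
  rwa [OrthonormalBasis.coe_toBasis] at this

lemma normDet_linearMapOfVectors (x : Fin p → EuclideanSpace ℝ (Fin n)) :
    (linearMapOfVectors x).normDet = √(Matrix.gram ℝ x).det := by
  have h := LinearMap.normDet_sq_eq_det_gram (linearMapOfVectors x)
    (EuclideanSpace.basisFun (Fin p) ℝ)
  simp only [linearMapOfVectors_basisFun] at h
  rw [← h]
  exact (Real.sqrt_sq (LinearMap.normDet_nonneg _)).symm

lemma euclideanHausdorffMeasure_image_linearMapOfVectors
    (x : Fin p → EuclideanSpace ℝ (Fin n)) (s : Set (EuclideanSpace ℝ (Fin p))) :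
    μHE[p] (linearMapOfVectors x '' s) = ENNReal.ofReal √(Matrix.gram ℝ x).det * volume s := by
  have h := (linearMapOfVectors x).euclideanHausdorffMeasure_image_eq_normDet_mul_volume s
  rwa [finrank_euclideanSpace_fin, normDet_linearMapOfVectors] at h

lemma parallelotopeVolume_eq (x : Fin p → EuclideanSpace ℝ (Fin n)) :
    parallelotopeVolume x = √(Matrix.gram ℝ x).det := by
  have h : parallelepiped x =
      linearMapOfVectors x '' parallelepiped (EuclideanSpace.basisFun (Fin p) ℝ) := by
    rw [image_parallelepiped]
    congr 1
    ext1 i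
    exact (linearMapOfVectors_basisFun x i).symm
  rw [parallelotopeVolume, h, euclideanHausdorffMeasure_image_linearMapOfVectors,
    OrthonormalBasis.volume_parallelepiped, mul_one, ENNReal.toReal_ofReal (Real.sqrt_nonneg _)]

lemma logParallelotope_eq (x : Fin p → EuclideanSpace ℝ (Fin n)) :
    logParallelotope x = 1 / 2 * logDetGram x := by
  rw [logParallelotope, parallelotopeVolume_eq, Real.log_sqrt, logDetGram]
  · ring
  · exact (Matrix.posSemidef_gram ℝ x).det_nonneg

/-- The convex hull of the origin and the standard basis vectors. -/
def cornerSimplex (p : ℕ) : Set (EuclideanSpace ℝ (Fin p)) :=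
  convexHull ℝ (Set.range (Fin.cons 0 (EuclideanSpace.basisFun (Fin p) ℝ) :
    Fin (p + 1) → EuclideanSpace ℝ (Fin p)))

/-- Only positivity matters: the volume enters the log-volume of a simplex as an additive constant.
-/
lemma toReal_volume_cornerSimplex_pos (p : ℕ) : 0 < (volume (cornerSimplex p)).toReal := by
  refine ENNReal.toReal_pos ?_ ?_
  · have hne : (interior (cornerSimplex p)).Nonempty := by
      rw [cornerSimplex, interior_convexHull_nonempty_iff_affineSpan_eq_top,
        AffineSubspace.affineSpan_eq_top_iff_vectorSpan_eq_top_of_nonempty _ _ _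
          (Set.range_nonempty _), eq_top_iff,
        ← (EuclideanSpace.basisFun (Fin p) ℝ).toBasis.span_eq, Submodule.span_le]
      rintro _ ⟨i, rfl⟩
      have := vsub_mem_vectorSpan ℝ
        (Set.mem_range_self (f := (Fin.cons 0 (EuclideanSpace.basisFun (Fin p) ℝ) :
          Fin (p + 1) → EuclideanSpace ℝ (Fin p))) i.succ) (Set.mem_range_self 0)
      simpa using this
    exact ((isOpen_interior.measure_pos volume hne).trans_le (measure_mono interior_subset)).ne'
  · exact ((Set.finite_range _).isCompact_convexHull ℝ).measure_lt_top.ne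

/-- The simplex is a translate of the image of the corner simplex under the linear map with the edge
vectors as columns. -/
lemma simplexVolume_eq (x : Fin (p + 1) → EuclideanSpace ℝ (Fin n)) :
    simplexVolume x = √(Matrix.gram ℝ fun i : Fin p => x i.succ - x 0).det *
      (volume (cornerSimplex p)).toReal := by
  set d := fun i : Fin p => x i.succ - x 0 with hd
  have h : convexHull ℝ (Set.range x) =
      (fun y => x 0 + y) '' (linearMapOfVectors d '' cornerSimplex p) := by
    have h1 := ((linearMapOfVectors d).toAffineMap).image_convexHull (Set.range
      (Fin.cons 0 (EuclideanSpace.basisFun (Fin p) ℝ) : Fin (p + 1) → EuclideanSpace ℝ (Fin p)))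
    rw [LinearMap.coe_toAffineMap] at h1
    rw [cornerSimplex, h1]
    have h2 := (AffineEquiv.constVAdd ℝ (EuclideanSpace ℝ (Fin n)) (x 0)).toAffineMap.image_convexHull
      (linearMapOfVectors d '' Set.range
        (Fin.cons 0 (EuclideanSpace.basisFun (Fin p) ℝ) : Fin (p + 1) → EuclideanSpace ℝ (Fin p)))
    refine Eq.trans ?_ h2.symm
    congr 1
    rw [← Set.range_comp, ← Set.range_comp]
    congr 1
    ext1 i
    refine Fin.cases ?_ (fun i => ?_) i
    · simp
    · simp only [Function.comp_apply, Fin.cons_succ, linearMapOfVectors_basisFun, hd]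
      simp
  rw [simplexVolume, h, (isometry_add_left (x 0)).euclideanHausdorffMeasure_image,
    euclideanHausdorffMeasure_image_linearMapOfVectors, ENNReal.toReal_mul,
    ENNReal.toReal_ofReal (Real.sqrt_nonneg _)]

lemma logSimplex_eq {x : Fin (p + 1) → EuclideanSpace ℝ (Fin n)}
    (hx : (Matrix.gram ℝ fun i : Fin p => x i.succ - x 0).det ≠ 0) :
    logSimplex x = 1 / 2 * logDetGram (fun i : Fin p => x i.succ - x 0) +
      Real.log (volume (cornerSimplex p)).toReal := by
  have h0 := (Matrix.posSemidef_gram ℝ fun i : Fin p => x i.succ - x 0).det_nonneg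
  rw [logSimplex, simplexVolume_eq, Real.log_mul (Real.sqrt_ne_zero'.2 (lt_of_le_of_ne h0 hx.symm))
    (toReal_volume_cornerSimplex_pos p).ne', Real.log_sqrt h0, logDetGram]
  ring

end Volume

/-! ### From the edges of a simplex to independent Gaussian points -/

section Mixing

/-- Compare characteristic functions: the transpose of `T` is isometric, and the Gaussian one
depends only on the norm. -/
lemma measurePreserving_stdGaussianPi_of_mul_transpose {E : Type*} [NormedAddCommGroup E]
    [InnerProductSpace ℝ E] [FiniteDimensional ℝ E] [MeasurableSpace E] [BorelSpace E] {m p : ℕ}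
    {T : Matrix (Fin p) (Fin m) ℝ} (hT : T * T.transpose = 1) :
    MeasurePreserving (fun (x : Fin m → E) i => ∑ j, T i j • x j)
      (stdGaussianPi E m) (stdGaussianPi E p) := by
  have hmeas : Measurable (fun (x : Fin m → E) i => ∑ j, T i j • x j) := by fun_prop
  refine ⟨hmeas, ?_⟩
  have := Measure.isProbabilityMeasure_map (μ := stdGaussianPi E m) hmeas.aemeasurable
  refine charFun_eq_pi_iff.1 fun t => ?_
  let t' : PiLp 2 (fun _ : Fin m => E) := WithLp.toLp 2 fun j => ∑ i, T i j • t i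
  have h1 : charFun (((stdGaussianPi E m).map fun x i => ∑ j, T i j • x j).map (WithLp.toLp 2)) t =
      charFun ((stdGaussianPi E m).map (WithLp.toLp 2)) t' := by
    rw [charFun_apply, charFun_apply, integral_map (by fun_prop) (by fun_prop),
      integral_map hmeas.aemeasurable (Measurable.aestronglyMeasurable (by fun_prop)),
      integral_map (by fun_prop) (by fun_prop)]
    congr 1
    ext x
    congr 3
    simp only [PiLp.inner_apply, t', sum_inner, inner_sum, real_inner_smul_left,
      real_inner_smul_right]
    exact Finset.sum_comm
  rw [h1, charFun_pi]
  simp only [charFun_stdGaussian, ← Complex.exp_sum]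
  congr 1
  have h2 : ∑ j, ‖t' j‖ ^ 2 = ∑ i, ‖t i‖ ^ 2 := by
    have h3 : ∀ i k, ∑ j, T i j * T k j = if i = k then 1 else 0 := fun i k => by
      have := congrFun (congrFun hT i) k
      simpa [Matrix.mul_apply, Matrix.one_apply] using this
    calc ∑ j, ‖t' j‖ ^ 2 = ∑ j, ∑ i, ∑ k, (T i j * T k j) * inner ℝ (t i) (t k) := by
          refine Finset.sum_congr rfl fun j _ => ?_
          rw [← real_inner_self_eq_norm_sq]
          simp only [t', sum_inner, inner_sum, real_inner_smul_left, real_inner_smul_right]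
          refine Finset.sum_congr rfl fun i _ => Finset.sum_congr rfl fun k _ => ?_
          rw [real_inner_comm]
          ring
      _ = ∑ i, ∑ k, (∑ j, T i j * T k j) * inner ℝ (t i) (t k) := by
          rw [Finset.sum_comm]
          refine Finset.sum_congr rfl fun i _ => ?_
          rw [Finset.sum_comm]
          simp only [Finset.sum_mul]
      _ = _ := by simp [h3]
  have h4 : ∑ j, (-(‖t' j‖ : ℂ) ^ 2 / 2) = -((∑ j, ‖t' j‖ ^ 2 : ℝ) : ℂ) / 2 := by
    push_cast
    rw [← Finset.sum_div, Finset.sum_neg_distrib]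
  have h5 : ∑ i, (-(‖t i‖ : ℂ) ^ 2 / 2) = -((∑ i, ‖t i‖ ^ 2 : ℝ) : ℂ) / 2 := by
    push_cast
    rw [← Finset.sum_div, Finset.sum_neg_distrib]
  rw [h4, h5, h2]

lemma exists_mul_transpose_eq_one_sum_eq_zero (p : ℕ) :
    ∃ T : Matrix (Fin p) (Fin (p + 1)) ℝ, T * T.transpose = 1 ∧ ∀ i, ∑ j, T i j = 0 := by
  let v : EuclideanSpace ℝ (Fin (p + 1)) := WithLp.toLp 2 fun _ => 1
  have hv : v ≠ 0 := fun h => by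
    have := congrArg (fun w : EuclideanSpace ℝ (Fin (p + 1)) => w 0) h
    simp [v] at this
  have : Fact (Module.finrank ℝ (EuclideanSpace ℝ (Fin (p + 1))) = p + 1) := ⟨by simp⟩
  let b := (stdOrthonormalBasis ℝ (Submodule.span ℝ {v})ᗮ).reindex
    (finCongr (Submodule.finrank_orthogonal_span_singleton (n := p) hv))
  refine ⟨Matrix.of fun i j => (b i : EuclideanSpace ℝ (Fin (p + 1))) j, ?_, fun i => ?_⟩
  · ext i k
    have := orthonormal_iff_ite.1 b.orthonormal k i
    rw [Submodule.coe_inner, PiLp.inner_apply] at this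
    simpa [Matrix.mul_apply, Matrix.one_apply, eq_comm] using this
  · have := Submodule.mem_orthogonal_singleton_iff_inner_right.1 (b i).2
    simpa [v, PiLp.inner_apply] using this

/-- The rows of `T` sum to zero, so the mixture depends only on the differences, through the square
matrix `B` of the remaining columns. As `T = B * D` and `T * Tᵀ = 1`, `B` is invertible, and the
constant is its squared determinant. -/
lemma exists_mix_differences (E : Type*) [NormedAddCommGroup E]
    [InnerProductSpace ℝ E] [FiniteDimensional ℝ E] [MeasurableSpace E] [BorelSpace E] (p : ℕ) :
    ∃ (f : (Fin (p + 1) → E) → Fin p → E) (c : ℝ), c ≠ 0 ∧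
      MeasurePreserving f (stdGaussianPi E (p + 1)) (stdGaussianPi E p) ∧
      ∀ x, (Matrix.gram ℝ (f x)).det =
        c * (Matrix.gram ℝ fun i : Fin p => x i.succ - x 0).det := by
  obtain ⟨T, hT, hT0⟩ := exists_mul_transpose_eq_one_sum_eq_zero p
  let B : Matrix (Fin p) (Fin p) ℝ := Matrix.of fun i j => T i j.succ
  have hf : ∀ x : Fin (p + 1) → E, (fun i => ∑ j, T i j • x j) =
      fun i => ∑ j, B i j • (x j.succ - x 0) := fun x => by
    ext1 i
    have h := hT0 i
    rw [Fin.sum_univ_succ] at h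
    rw [Fin.sum_univ_succ, eq_neg_of_add_eq_zero_left h]
    simp only [B, Matrix.of_apply, smul_sub, Finset.sum_sub_distrib, ← Finset.sum_smul]
    rw [neg_smul]
    abel
  have hB : B.det ≠ 0 := by
    let D : Matrix (Fin p) (Fin (p + 1)) ℝ :=
      Matrix.of fun i => Fin.cons (-1) (Pi.single i 1)
    have hBD : T = B * D := by
      ext i j
      refine Fin.cases ?_ (fun j => ?_) j
      · have h := hT0 i
        rw [Fin.sum_univ_succ] at h
        simp [Matrix.mul_apply, D, B, eq_neg_of_add_eq_zero_left h]
      · simp [Matrix.mul_apply, D, B, Pi.single_apply]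
    have h : B * (D * T.transpose) = 1 := by rw [← Matrix.mul_assoc, ← hBD, hT]
    have h' := congrArg Matrix.det h
    rw [Matrix.det_mul, Matrix.det_one] at h'
    exact left_ne_zero_of_mul_eq_one h'
  refine ⟨fun x i => ∑ j, T i j • x j, B.det * B.det, mul_ne_zero hB hB,
    measurePreserving_stdGaussianPi_of_mul_transpose hT, fun x => ?_⟩
  change (Matrix.gram ℝ fun i => ∑ j, T i j • x j).det = _
  rw [hf x, gram_sum_smul, Matrix.det_mul, Matrix.det_mul, Matrix.det_transpose]
  ring

end Mixing

/-! ### Reduction of the three gaps to one -/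

section Gaps

variable {n p : ℕ}

lemma isLogChiSqSum_gaussian (hpn : p ≤ n) :
    IsLogChiSqSum n p (stdGaussianPi (EuclideanSpace ℝ (Fin n)) p) logDetGram := by
  have h := isLogChiSqSum_logDetGram (E := EuclideanSpace ℝ (Fin n)) (p := p) (by simpa using hpn)
  rwa [finrank_euclideanSpace_fin] at h

instance : IsProbabilityMeasure (gaussianMatrix n p) := by
  unfold gaussianMatrix; infer_instance

instance : IsProbabilityMeasure (gaussianPoints n p) := by
  unfold gaussianPoints; infer_instance

lemma logDetLaguerre_ae_eq : (logDetLaguerre (n := n) (p := p)) =ᵐ[gaussianMatrix n p]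
    fun A => 1 * logDetGram (fun j : Fin p =>
      (WithLp.toLp 2 fun i => A i j : EuclideanSpace ℝ (Fin n))) + 0 :=
  .of_forall fun A => by simp only [logDetLaguerre, det_laguerreMatrix, logDetGram]; ring

lemma logParallelotope_ae_eq : (logParallelotope (n := n) (p := p)) =ᵐ[gaussianPoints n p]
    fun x => 1 / 2 * logDetGram (id x) + 0 :=
  .of_forall fun x => by simp only [logParallelotope_eq, id]; ring

lemma exists_logSimplex_ae_eq (hpn : p ≤ n) :
    ∃ (f : (Fin (p + 1) → EuclideanSpace ℝ (Fin n)) → Fin p → EuclideanSpace ℝ (Fin n)) (b : ℝ),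
      MeasurePreserving f (gaussianPoints n (p + 1))
        (stdGaussianPi (EuclideanSpace ℝ (Fin n)) p) ∧
      (logSimplex (n := n) (p := p)) =ᵐ[gaussianPoints n (p + 1)]
        fun x => 1 / 2 * logDetGram (f x) + b := by
  obtain ⟨f, c, hc, hf, hdet⟩ := exists_mix_differences (EuclideanSpace ℝ (Fin n)) p
  refine ⟨f, Real.log (volume (cornerSimplex p)).toReal - 1 / 2 * Real.log c, hf, ?_⟩
  have hae := ae_det_gram_ne_zero (E := EuclideanSpace ℝ (Fin n)) (p := p) (by simpa using hpn)
  rw [← hf.map_eq] at hae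
  filter_upwards [ae_of_ae_map hf.measurable.aemeasurable hae] with x hx
  rw [hdet] at hx
  have hd := right_ne_zero_of_mul hx
  rw [logSimplex_eq hd, logDetGram, logDetGram, hdet, Real.log_mul hc hd]
  ring

lemma standardizable_all (hp : 1 ≤ p) (hpn : p ≤ n) :
    Standardizable (gaussianMatrix n p) (logDetLaguerre (n := n) (p := p)) ∧
    Standardizable (gaussianPoints n p) (logParallelotope (n := n) (p := p)) ∧
    Standardizable (gaussianPoints n (p + 1)) (logSimplex (n := n) (p := p)) := by
  have h := (isLogChiSqSum_gaussian hpn).standardizable hp hpn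
  obtain ⟨f, b, hf, hfX⟩ := exists_logSimplex_ae_eq hpn
  exact ⟨h.of_ae_eq_affine (measurePreserving_toLp_transpose n p) measurable_logDetGram one_pos
      logDetLaguerre_ae_eq,
    h.of_ae_eq_affine (MeasurePreserving.id _) measurable_logDetGram (by norm_num)
      logParallelotope_ae_eq,
    h.of_ae_eq_affine hf measurable_logDetGram (by norm_num) hfX⟩

lemma gap_eq {k : ℕ} {gap : ℕ → ℕ → ℝ}
    (hgap : gap ∈ ({laguerreGap k, parallelotopeGap k, simplexGap k} : Set (ℕ → ℕ → ℝ)))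
    (hp : 1 ≤ p) (hpn : p ≤ n) :
    gap n p = momentGap (stdGaussianPi (EuclideanSpace ℝ (Fin n)) p) logDetGram k := by
  have h := (isLogChiSqSum_gaussian hpn).standardizable hp hpn
  rcases hgap with rfl | rfl | rfl
  · exact momentGap_of_ae_eq_affine h (measurePreserving_toLp_transpose n p)
      measurable_logDetGram one_pos logDetLaguerre_ae_eq k
  · exact momentGap_of_ae_eq_affine h (MeasurePreserving.id _) measurable_logDetGram
      (by norm_num) logParallelotope_ae_eq k
  · obtain ⟨f, b, hf, hfX⟩ := exists_logSimplex_ae_eq hpn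
    exact momentGap_of_ae_eq_affine h hf measurable_logDetGram (by norm_num) hfX k

end Gaps

/-! ### Asymptotic conditions on the sequence -/

section Sequences

/-- Only finitely many indices are exceptional, and the sum of their ratios `|f n / g n|` dominates
each of them. -/
lemma exists_forall_le_of_eventually_le {f g : ℕ → ℝ} {S : Set ℕ} {C : ℝ}
    (h : ∀ᶠ n in atTop, f n ≤ C * g n) (hg : ∀ n ∈ S, 0 < g n) :
    ∃ C' : ℝ, ∀ n ∈ S, f n ≤ C' * g n := by
  obtain ⟨N, hN⟩ := eventually_atTop.1 h
  refine ⟨max C (∑ n ∈ Finset.range N, |f n / g n|), fun n hn => ?_⟩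
  have hgn := hg n hn
  by_cases hnN : N ≤ n
  · exact (hN n hnN).trans (mul_le_mul_of_nonneg_right (le_max_left _ _) hgn.le)
  · rw [← div_le_iff₀ hgn]
    refine (le_abs_self _).trans (le_trans ?_ (le_max_right _ _))
    exact Finset.single_le_sum (f := fun n => |f n / g n|) (fun i _ => abs_nonneg _)
      (Finset.mem_range.2 (not_le.1 hnN))

lemma eventually_le_half_mul {p : ℕ → ℕ}
    (h : (fun n => (p n : ℝ)) =o[atTop] fun n : ℕ => (n : ℝ)) :
    ∀ᶠ n : ℕ in atTop, (p n : ℝ) ≤ 1 / 2 * n := by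
  filter_upwards [h.def (show (0:ℝ) < 1 / 2 by norm_num)] with n hn
  simpa using hn

lemma eventually_le_mul_of_isEquivalent {p : ℕ → ℕ} {c : ℝ} (hc0 : 0 < c) (hc1 : c < 1)
    (h : (fun n => (p n : ℝ)) ~[atTop] fun n : ℕ => c * (n : ℝ)) :
    ∀ᶠ n : ℕ in atTop, (p n : ℝ) ≤ (1 + c) / 2 * n := by
  -- The tolerance makes the error `(1 - c) / 2 * n`, and `c + (1 - c) / 2 = (1 + c) / 2 < 1`.
  filter_upwards [h.isLittleO.def (show (0:ℝ) < (1 - c) / (2 * c) by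
    have : 0 < 1 - c := by linarith
    positivity)] with n hn
  simp only [Pi.sub_apply, Real.norm_eq_abs] at hn
  rw [abs_of_nonneg (by positivity : (0:ℝ) ≤ c * n),
    show (1 - c) / (2 * c) * (c * (n:ℝ)) = (1 - c) / 2 * n by field_simp] at hn
  linarith [le_abs_self ((p n : ℝ) - c * n)]

lemma eventually_one_le_log {p : ℕ → ℕ} (hp : ∀ n, 1 ≤ n → 1 ≤ p n ∧ p n ≤ n)
    (h : (fun n : ℕ => (n : ℝ) - (p n : ℝ)) =o[atTop] fun n : ℕ => (n : ℝ)) :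
    ∀ᶠ n : ℕ in atTop, 1 ≤ Real.log ((n : ℝ) / ((n : ℝ) - (p n : ℝ) + 1)) := by
  have he := Real.exp_pos 1
  -- One half of `n` absorbs `e (n - p)` and the other half absorbs `e`, so `e (n - p + 1) ≤ n`.
  filter_upwards [h.def (show (0:ℝ) < (Real.exp 1)⁻¹ / 2 by positivity), eventually_ge_atTop 1,
    tendsto_natCast_atTop_atTop.eventually_ge_atTop (2 * Real.exp 1)] with n hn h1 h2
  have hpn : (p n : ℝ) ≤ n := by exact_mod_cast (hp n h1).2
  have hpos : 0 < (n : ℝ) - p n + 1 := by linarith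
  have hn0 : (0:ℝ) < n := by exact_mod_cast h1
  rw [Real.norm_of_nonneg (by linarith), Real.norm_of_nonneg hn0.le] at hn
  rw [Real.le_log_iff_exp_le (by positivity), le_div_iff₀ hpos]
  have h3 : Real.exp 1 * ((n:ℝ) - p n) ≤ n / 2 := by
    calc Real.exp 1 * ((n:ℝ) - p n) ≤ Real.exp 1 * ((Real.exp 1)⁻¹ / 2 * n) := by gcongr
      _ = n / 2 := by field_simp
  linarith

lemma one_div_log_pos {n p : ℕ} (hp : 2 ≤ p) (hpn : p ≤ n) :
    0 < 1 / Real.log ((n : ℝ) / ((n : ℝ) - (p : ℝ) + 1)) := by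
  have h1 : (2:ℝ) ≤ p := by exact_mod_cast hp
  have h2 : (p:ℝ) ≤ n := by exact_mod_cast hpn
  refine one_div_pos.2 (Real.log_pos ?_)
  rw [one_lt_div (by linarith)]
  linarith

end Sequences

end LogDet

end

/-! ### The main theorem -/

theorem mainTheorem7 (k : ℕ) (hk : Even k) :
    -- all random variables have finite moments and positive variance
    (∀ n p : ℕ, 1 ≤ p → p ≤ n →
      LogDet.Standardizable (LogDet.gaussianMatrix n p)
        (LogDet.logDetLaguerre (n := n) (p := p)) ∧
      LogDet.Standardizable (LogDet.gaussianPoints n p)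
        (LogDet.logParallelotope (n := n) (p := p)) ∧
      LogDet.Standardizable (LogDet.gaussianPoints n (p + 1))
        (LogDet.logSimplex (n := n) (p := p))) ∧
    ∀ gap ∈ ({LogDet.laguerreGap k, LogDet.parallelotopeGap k, LogDet.simplexGap k} :
        Set (ℕ → ℕ → ℝ)),
      -- the case `p(n) = o(n)`
      (∃ C : ℝ, ∀ p : ℕ → ℕ, (∀ n, 1 ≤ n → 1 ≤ p n ∧ p n ≤ n) →
        ((fun n => (p n : ℝ)) =o[atTop] fun n : ℕ => (n : ℝ)) →
          (∀ᶠ n : ℕ in atTop, gap n (p n) ≤ C * (1 / ((p n : ℝ) * n))) ∧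
          ∃ C' : ℝ, ∀ n : ℕ, 1 ≤ n → gap n (p n) ≤ C' * (1 / ((p n : ℝ) * n))) ∧
      -- the case `p(n) ∼ c n` with `0 < c < 1`
      (∀ c : ℝ, 0 < c → c < 1 →
        ∃ C : ℝ, ∀ p : ℕ → ℕ, (∀ n, 1 ≤ n → 1 ≤ p n ∧ p n ≤ n) →
        ((fun n => (p n : ℝ)) ~[atTop] fun n : ℕ => c * (n : ℝ)) →
          (∀ᶠ n : ℕ in atTop, gap n (p n) ≤ C * (1 / ((p n : ℝ) * n))) ∧
          ∃ C' : ℝ, ∀ n : ℕ, 1 ≤ n → gap n (p n) ≤ C' * (1 / ((p n : ℝ) * n))) ∧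
      -- the case `n - p(n) = o(n)`
      (∃ C : ℝ, ∀ p : ℕ → ℕ, (∀ n, 1 ≤ n → 1 ≤ p n ∧ p n ≤ n) →
        ((fun n : ℕ => (n : ℝ) - (p n : ℝ)) =o[atTop] fun n : ℕ => (n : ℝ)) →
          (∀ᶠ n : ℕ in atTop,
            gap n (p n) ≤ C * (1 / Real.log ((n : ℝ) / ((n : ℝ) - (p n : ℝ) + 1)))) ∧
          ∃ C' : ℝ, ∀ n : ℕ, 2 ≤ p n → 1 ≤ n →
            gap n (p n) ≤ C' * (1 / Real.log ((n : ℝ) / ((n : ℝ) - (p n : ℝ) + 1)))) := by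
  refine ⟨fun n p hp hpn => LogDet.standardizable_all hp hpn, fun gap hgap => ?_⟩
  -- Both regimes of part (1) only need `p n ≤ θ n` eventually: `θ = 1 / 2` for `o(n)` and `θ = (1 +
  -- c) / 2` for `c n`.
  have hsmall : ∀ θ : ℝ, θ < 1 → ∃ C : ℝ, ∀ p : ℕ → ℕ, (∀ n, 1 ≤ n → 1 ≤ p n ∧ p n ≤ n) →
      (∀ᶠ n : ℕ in atTop, (p n : ℝ) ≤ θ * n) →
      (∀ᶠ n : ℕ in atTop, gap n (p n) ≤ C * (1 / ((p n : ℝ) * n))) ∧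
        ∃ C' : ℝ, ∀ n : ℕ, 1 ≤ n → gap n (p n) ≤ C' * (1 / ((p n : ℝ) * n)) := by
    intro θ hθ
    obtain ⟨C, -, hC⟩ := LogDet.exists_momentGap_le_inv_mul hk hθ
    refine ⟨C, fun p hp hpθ => ?_⟩
    have hev : ∀ᶠ n : ℕ in atTop, gap n (p n) ≤ C * (1 / ((p n : ℝ) * n)) := by
      filter_upwards [hpθ, eventually_ge_atTop 1] with n hn h1
      obtain ⟨h2, h3⟩ := hp n h1
      rw [LogDet.gap_eq hgap h2 h3]
      exact hC n (p n) h2 h3 hn _ _ (LogDet.isLogChiSqSum_gaussian h3)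
    refine ⟨hev, LogDet.exists_forall_le_of_eventually_le (S := {n | 1 ≤ n}) hev fun n hn => ?_⟩
    have hn : 1 ≤ n := hn
    have := (hp n hn).1
    positivity
  refine ⟨?_, fun c hc0 hc1 => ?_, ?_⟩
  · obtain ⟨C, hC⟩ := hsmall (1 / 2) (by norm_num)
    exact ⟨C, fun p hp h => hC p hp (LogDet.eventually_le_half_mul h)⟩
  · obtain ⟨C, hC⟩ := hsmall ((1 + c) / 2) (by linarith)
    exact ⟨C, fun p hp h => hC p hp (LogDet.eventually_le_mul_of_isEquivalent hc0 hc1 h)⟩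
  · obtain ⟨C, -, hC⟩ := LogDet.exists_momentGap_le_inv_log hk
    refine ⟨C, fun p hp h => ?_⟩
    have hev : ∀ᶠ n : ℕ in atTop,
        gap n (p n) ≤ C * (1 / Real.log ((n : ℝ) / ((n : ℝ) - (p n : ℝ) + 1))) := by
      filter_upwards [LogDet.eventually_one_le_log hp h, eventually_ge_atTop 1] with n hn h1
      obtain ⟨h2, h3⟩ := hp n h1
      rw [LogDet.gap_eq hgap h2 h3]
      exact hC n (p n) h2 h3 hn _ _ (LogDet.isLogChiSqSum_gaussian h3)
    -- At `p n = 1` the logarithm is `0`, so positivity of the bound needs `2 ≤ p n`.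
    obtain ⟨C', hC'⟩ := LogDet.exists_forall_le_of_eventually_le
      (S := {n | 2 ≤ p n ∧ 1 ≤ n}) hev fun n hn => LogDet.one_div_log_pos hn.1 (hp n hn.2).2
    exact ⟨hev, C', fun n h2 h1 => hC' n ⟨h2, h1⟩⟩
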